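/- Let $(\Omega,\mu)$ be a measure space with $\mu(\Omega)=\infty$. Functions are identified when they agree a.e.; let $\mathcal L^0$ (respectively $\mathcal L^0_h$) be the space of a.e. finite complex-valued (respectively real-valued) measurable functions on $\Omega$, and let $\mathcal L^1$, $\mathcal L^\infty$ be formed within $\mathcal L^0$ or, in the real case, within $\mathcal L^0_h$. For $f\in\mathcal L^1+\mathcal L^\infty$ put $$\mu_t(f)=\inf\{\lambda>0:\ \mu\{|f|>\lambda\}\le t\},\qquad t>0.$$ A *fully symmetric space* is a Banach space $(E,\|\cdot\|_E)$, $E\subset\mathcal L^1+\mathcal L^\infty$, such that whenever $f\in E$, $g\in\mathcal L^1+\mathcal L^\infty$ and $\int_0^s\mu_t(g)\,dt\le\int_0^s\mu_t(f)\,dt$ for all $s>0$, one has $g\in E$ and $\|g\|_E\le\|f\|_E$. A *Dunford–Schwartz operator* is a linear operator $T:\mathcal L^1+\mathcal L^\infty\to\mathcal L^1+\mathcal L^\infty$ with $\|Tf\|_1\le\|f\|_1$ for all $f\in\mathcal L^1$ and $\|Tf\|_\infty\le\|f\|_\infty$ for all $f\in\mathcal L^\infty$; it is *positive* if $Tf\ge0$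 whenever $f\ge0$. **Theorem.** Let $E$ be a fully symmetric space which does not contain the constant function $\mathbf 1$. Assume that either 1. all spaces consist of real-valued functions ($E\subset\mathcal L^0_h$) and $T$ is a Dunford–Schwartz operator, or 2. the spaces consist of complex-valued functions ($E\subset\mathcal L^0$) and $T$ is a positive Dunford–Schwartz operator. Then for every $f\in E$ the averages $$\frac1n\sum_{k=0}^{n-1}T^k(f)$$ converge a.e., as $n\to\infty$, to some $\widehat f\in E$. -/

import Mathlib

open MeasureTheory Filter Topology
open scoped ENNReal

noncomputable section

namespace ErgodicFS

variable {Ω : Type*} [MeasurableSpace Ω] (𝕜 : Type*) [RCLike 𝕜] (μ : Measure Ω)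

/-- The space `L¹ + L^∞` of `𝕜`-valued functions, as a subspace of the space `L⁰` of classes of
a.e. equal measurable functions. -/
def L1AddLinf : Submodule 𝕜 (Ω →ₘ[μ] 𝕜) :=
  Lp.LpSubmodule 𝕜 𝕜 1 μ ⊔ Lp.LpSubmodule 𝕜 𝕜 ∞ μ

variable {𝕜 μ}

/-- The non-increasing rearrangement `μ_t(f) = inf {l > 0 : μ {|f| > l} ≤ t}`, with values in
`[0, ∞]`; it is finite for `t > 0` if `f ∈ L¹ + L^∞`. -/
def rearrangement (f : Ω →ₘ[μ] 𝕜) (t : ℝ) : ℝ≥0∞ :=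
  sInf {l : ℝ≥0∞ | 0 < l ∧ μ {x | l < ‖f x‖ₑ} ≤ ENNReal.ofReal t}

/-- The relation `g ≺≺ f`: `∫₀ˢ μ_t(g) dt ≤ ∫₀ˢ μ_t(f) dt` for all `s > 0`. -/
def Submajorized (g f : Ω →ₘ[μ] 𝕜) : Prop :=
  ∀ s : ℝ, 0 < s →
    ∫⁻ t in Set.Ioo 0 s, rearrangement g t ≤ ∫⁻ t in Set.Ioo 0 s, rearrangement f t

variable (𝕜 μ)

/-- A fully symmetric space: a Banach space `(E, ‖·‖_E)` contained in `L¹ + L^∞` such that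
`f ∈ E`, `g ∈ L¹ + L^∞` and `g ≺≺ f` imply `g ∈ E` and `‖g‖_E ≤ ‖f‖_E`. -/
structure FullySymmetricSpace where
  /-- the underlying linear space `E` -/
  carrier : Submodule 𝕜 (Ω →ₘ[μ] 𝕜)
  carrier_le : carrier ≤ L1AddLinf 𝕜 μ
  /-- the norm `‖·‖_E` -/
  nrm : Seminorm 𝕜 carrier
  eq_zero_of_nrm_eq_zero : ∀ f : carrier, nrm f = 0 → f = 0
  complete : ∀ u : ℕ → carrier,
    (∀ ε : ℝ, 0 < ε → ∃ N : ℕ, ∀ m ≥ N, ∀ n ≥ N, nrm (u m - u n) < ε) →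
      ∃ f : carrier, Tendsto (fun n => nrm (u n - f)) atTop (𝓝 0)
  fully_symmetric : ∀ (f : carrier) (g : Ω →ₘ[μ] 𝕜), g ∈ L1AddLinf 𝕜 μ →
    Submajorized g (f : Ω →ₘ[μ] 𝕜) → ∃ hg : g ∈ carrier, nrm ⟨g, hg⟩ ≤ nrm f

variable {𝕜 μ}

/-- Dunford–Schwartz operators: linear operators on `L¹ + L^∞` that contract both the norm of
`L¹` and the norm of `L^∞`. -/
def IsDunfordSchwartz (T : Module.End 𝕜 (L1AddLinf 𝕜 μ)) : Prop :=
  (∀ f : L1AddLinf 𝕜 μ, (f : Ω →ₘ[μ] 𝕜) ∈ Lp.LpSubmodule 𝕜 𝕜 1 μ →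
    eLpNorm (T f : Ω →ₘ[μ] 𝕜) 1 μ ≤ eLpNorm (f : Ω →ₘ[μ] 𝕜) 1 μ) ∧
  (∀ f : L1AddLinf 𝕜 μ, (f : Ω →ₘ[μ] 𝕜) ∈ Lp.LpSubmodule 𝕜 𝕜 ∞ μ →
    eLpNorm (T f : Ω →ₘ[μ] 𝕜) ∞ μ ≤ eLpNorm (f : Ω →ₘ[μ] 𝕜) ∞ μ)

/-- `f ≥ 0` almost everywhere (in particular `f` is real-valued almost everywhere). -/
def IsNonneg (f : Ω →ₘ[μ] 𝕜) : Prop :=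
  ∀ᵐ x ∂μ, 0 ≤ RCLike.re (f x) ∧ RCLike.im (f x) = 0

/-- Positive operators: `f ≥ 0` implies `T f ≥ 0`. -/
def IsPositiveOperator (T : Module.End 𝕜 (L1AddLinf 𝕜 μ)) : Prop :=
  ∀ f : L1AddLinf 𝕜 μ, IsNonneg (f : Ω →ₘ[μ] 𝕜) → IsNonneg (T f : Ω →ₘ[μ] 𝕜)

/-- The ergodic average `(1/n) ∑_{k<n} T^k f`. -/
def ergodicAverage (T : Module.End 𝕜 (L1AddLinf 𝕜 μ)) (n : ℕ) (f : L1AddLinf 𝕜 μ) :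
    L1AddLinf 𝕜 μ :=
  (n : 𝕜)⁻¹ • ∑ k ∈ Finset.range n, (T ^ k) f

/-- For every `f ∈ E` the averages of `f` under `T` converge a.e. to some element of `E`. -/
def AveragesConvergeIn (E : FullySymmetricSpace 𝕜 μ)
    (T : Module.End 𝕜 (L1AddLinf 𝕜 μ)) : Prop :=
  ∀ (f : Ω →ₘ[μ] 𝕜) (hf : f ∈ E.carrier), ∃ fhat ∈ E.carrier, ∀ᵐ x ∂μ,
    Tendsto (fun n : ℕ => (ergodicAverage T n ⟨f, E.carrier_le hf⟩ : Ω →ₘ[μ] 𝕜) x) atTop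
      (𝓝 (fhat x))

end ErgodicFS

end

noncomputable section

namespace ErgodicFS

variable {Ω : Type*} [MeasurableSpace Ω] {𝕜 : Type*} [RCLike 𝕜] {μ : Measure Ω}

/-! ### Layer cake formulas for functions with values in `[0, ∞]` -/

/-! Everything is expressed through the excess `∫ (|f| - a)⁺`, which is the least `L¹` norm of `f -
h` over all `h` with `‖h‖_∞ ≤ a`; clipping `f` at height `a` attains it. Hence a Dunford–Schwartz
operator decreases every excess (`IsDunfordSchwartz.excess_le`), and so do its averages. Conversely,
smaller excesses at all finite levels imply submajorization (`submajorized_of_excess_le`).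

If `f ∈ E` had `μ {|f| > a} = ∞` for some `a > 0`, then `a • 1` would be submajorized by `f`,
forcing `1 ∈ E`. So every `f ∈ E` has finite excess over each positive level. For such `f` a.e.
convergence follows from a Banach principle with `L²` as the approximating class. On `L²`, which `T`
also contracts, fixed vectors plus coboundaries `g - T g` are dense, and their averages visibly
converge. The maximal inequality behind the principle comes from a filling scheme that uses only the
`L¹` and `L^∞` contractions.

Finally, Fatou's lemma bounds the excesses of the limit by those of `f`, so full symmetry puts the
limit in `E`. -/

theorem lintegral_le_lintegral_measure_ofReal_lt {f : Ω → ℝ≥0∞} (hf : AEMeasurable f μ) :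
    ∫⁻ x, f x ∂μ ≤ ∫⁻ l in Set.Ioi (0 : ℝ), μ {x | ENNReal.ofReal l < f x} := by
  by_cases h : ∀ᵐ x ∂μ, f x ≠ ∞
  · have h1 : ∫⁻ x, f x ∂μ = ∫⁻ x, ENNReal.ofReal (f x).toReal ∂μ :=
      lintegral_congr_ae (h.mono fun x hx => (ENNReal.ofReal_toReal hx).symm)
    rw [h1, lintegral_eq_lintegral_meas_lt μ (Eventually.of_forall fun x => ENNReal.toReal_nonneg)
      hf.ennreal_toReal]
    refine setLIntegral_mono' measurableSet_Ioi fun l hl => measure_mono_ae ?_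
    filter_upwards [h] with x hx hlx
    exact (ENNReal.ofReal_lt_iff_lt_toReal hl.le hx).2 hlx
  · have h0 : μ {x | f x = ∞} ≠ 0 := by
      simpa [ae_iff] using h
    have : ∫⁻ _ in Set.Ioi (0 : ℝ), μ {x | f x = ∞} ≤
        ∫⁻ l in Set.Ioi (0 : ℝ), μ {x | ENNReal.ofReal l < f x} := by
      refine lintegral_mono fun l => measure_mono fun x hx => ?_
      simp only [Set.mem_ofPred_eq] at hx ⊢
      simp [hx]
    refine le_trans ?_ this
    simp [ENNReal.mul_top h0]

/-- If the integral is finite, `f` is finite a.e. and the real layer cake formula applies. This and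
the preceding inequality are used as a pair: integrals over different spaces are compared level by
level through distribution functions. -/
theorem lintegral_measure_ofReal_le_le_lintegral {f : Ω → ℝ≥0∞} (hf : AEMeasurable f μ) :
    ∫⁻ l in Set.Ioi (0 : ℝ), μ {x | ENNReal.ofReal l ≤ f x} ≤ ∫⁻ x, f x ∂μ := by
  by_cases h0 : ∫⁻ x, f x ∂μ = ∞
  · simp [h0]
  have h : ∀ᵐ x ∂μ, f x ≠ ∞ := (ae_lt_top' hf h0).mono fun x hx => hx.ne
  have h1 : ∫⁻ x, f x ∂μ = ∫⁻ x, ENNReal.ofReal (f x).toReal ∂μ :=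
    lintegral_congr_ae (h.mono fun x hx => (ENNReal.ofReal_toReal hx).symm)
  rw [h1, lintegral_eq_lintegral_meas_le μ (Eventually.of_forall fun x => ENNReal.toReal_nonneg)
    hf.ennreal_toReal]
  refine lintegral_mono fun l => measure_mono_ae ?_
  filter_upwards [h] with x hx hlx
  exact (ENNReal.ofReal_le_iff_le_toReal hx).1 hlx

/-! ### Clipping scalars to a ball -/

/-- The point of the ball of radius `a` around `0` which is closest to `z`. -/
def clip (a : ℝ) (z : 𝕜) : 𝕜 := ((min 1 (a / ‖z‖) : ℝ) : 𝕜) * z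

theorem measurable_clip : Measurable fun p : ℝ × 𝕜 => clip p.1 p.2 := by
  unfold clip
  exact (RCLike.measurable_ofReal.comp
    (measurable_const.min (measurable_fst.div measurable_snd.norm))).mul measurable_snd

theorem norm_clip {a : ℝ} (ha : 0 ≤ a) (z : 𝕜) : ‖clip a z‖ = min ‖z‖ a := by
  rcases eq_or_ne z 0 with rfl | hz
  · simp [clip, ha]
  have hz' : 0 < ‖z‖ := norm_pos_iff.2 hz
  rw [clip, norm_mul, RCLike.norm_ofReal, abs_of_nonneg (by positivity),
    min_mul_of_nonneg _ _ hz'.le, one_mul, div_mul_cancel₀ _ hz'.ne']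

theorem norm_sub_clip {a : ℝ} (ha : 0 ≤ a) (z : 𝕜) : ‖z - clip a z‖ = ‖z‖ - min ‖z‖ a := by
  rcases eq_or_ne z 0 with rfl | hz
  · simp [clip, ha]
  have hz' : 0 < ‖z‖ := norm_pos_iff.2 hz
  have h1 : z - clip a z = ((1 - min 1 (a / ‖z‖) : ℝ) : 𝕜) * z := by
    rw [clip]; push_cast; ring
  rw [h1, norm_mul, RCLike.norm_ofReal, abs_of_nonneg (by simp), sub_mul,
    min_mul_of_nonneg _ _ hz'.le, one_mul, div_mul_cancel₀ _ hz'.ne']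

theorem enorm_clip_le {a : ℝ} (ha : 0 ≤ a) (z : 𝕜) : ‖clip a z‖ₑ ≤ ENNReal.ofReal a := by
  rw [← ofReal_norm, norm_clip ha]
  exact ENNReal.ofReal_le_ofReal (min_le_right _ _)

theorem enorm_sub_clip {a : ℝ} (ha : 0 ≤ a) (z : 𝕜) :
    ‖z - clip a z‖ₑ = ‖z‖ₑ - ENNReal.ofReal a := by
  rw [← ofReal_norm, norm_sub_clip ha, ← ofReal_norm, ← ENNReal.ofReal_sub _ ha]
  rcases le_total ‖z‖ a with h | h
  · simp [min_eq_left h, ENNReal.ofReal_of_nonpos (sub_nonpos.2 h)]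
  · simp [min_eq_right h]

/-- Clipping a class of functions to the ball of radius `a`. -/
def clipAE (a : ℝ) (f : Ω →ₘ[μ] 𝕜) : Ω →ₘ[μ] 𝕜 :=
  AEEqFun.compMeasurable (clip a) (measurable_clip.comp measurable_prodMk_left) f

theorem coeFn_clipAE (a : ℝ) (f : Ω →ₘ[μ] 𝕜) : clipAE a f =ᵐ[μ] fun x => clip a (f x) :=
  AEEqFun.coeFn_compMeasurable _ _ _

/-! ### The excess of a function over a level -/

/-- The excess `∫ (|f| - a)⁺ dμ` of `|f|` over the level `a`. -/
def excess (f : Ω →ₘ[μ] 𝕜) (a : ℝ≥0∞) : ℝ≥0∞ := ∫⁻ x, (‖f x‖ₑ - a) ∂μ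

theorem eLpNorm_top_clipAE_le {a : ℝ} (ha : 0 ≤ a) (f : Ω →ₘ[μ] 𝕜) :
    eLpNorm (clipAE a f) ∞ μ ≤ ENNReal.ofReal a := by
  rw [eLpNorm_exponent_top]
  refine essSup_le_of_ae_le _ ?_
  filter_upwards [coeFn_clipAE a f] with x hx
  rw [hx]
  exact enorm_clip_le ha _

theorem eLpNorm_one_sub_clipAE {a : ℝ} (ha : 0 ≤ a) (f : Ω →ₘ[μ] 𝕜) :
    eLpNorm (f - clipAE a f : Ω →ₘ[μ] 𝕜) 1 μ = excess f (ENNReal.ofReal a) := by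
  rw [eLpNorm_one_eq_lintegral_enorm, excess]
  refine lintegral_congr_ae ?_
  filter_upwards [coeFn_clipAE a f, AEEqFun.coeFn_sub f (clipAE a f)] with x hx hs
  rw [hs, Pi.sub_apply, hx, enorm_sub_clip ha]

theorem mem_LpSubmodule_iff {p : ℝ≥0∞} {f : Ω →ₘ[μ] 𝕜} :
    f ∈ Lp.LpSubmodule 𝕜 𝕜 p μ ↔ eLpNorm f p μ < ∞ := Iff.rfl

theorem clipAE_mem_Linf {a : ℝ} (ha : 0 ≤ a) (f : Ω →ₘ[μ] 𝕜) :
    clipAE a f ∈ Lp.LpSubmodule 𝕜 𝕜 ∞ μ :=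
  mem_LpSubmodule_iff.2 ((eLpNorm_top_clipAE_le ha f).trans_lt ENNReal.ofReal_lt_top)

theorem sub_clipAE_mem_L1 {a : ℝ} (ha : 0 ≤ a) {f : Ω →ₘ[μ] 𝕜}
    (h : excess f (ENNReal.ofReal a) ≠ ∞) : f - clipAE a f ∈ Lp.LpSubmodule 𝕜 𝕜 1 μ :=
  mem_LpSubmodule_iff.2 ((eLpNorm_one_sub_clipAE ha f).trans_lt h.lt_top)

theorem L1_le : Lp.LpSubmodule 𝕜 𝕜 1 μ ≤ L1AddLinf 𝕜 μ := le_sup_left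

theorem Linf_le : Lp.LpSubmodule 𝕜 𝕜 ∞ μ ≤ L1AddLinf 𝕜 μ := le_sup_right

theorem mem_L1AddLinf_of_excess_ne_top {f : Ω →ₘ[μ] 𝕜} {a : ℝ≥0∞} (ha : a ≠ ∞)
    (h : excess f a ≠ ∞) : f ∈ L1AddLinf 𝕜 μ := by
  rw [← ENNReal.ofReal_toReal ha] at h
  rw [← sub_add_cancel f (clipAE a.toReal f)]
  exact add_mem (L1_le (sub_clipAE_mem_L1 ENNReal.toReal_nonneg h))
    (Linf_le (clipAE_mem_Linf ENNReal.toReal_nonneg f))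

/-- Pointwise `|g + h| - a ≤ |g|`: the excess over `a` ignores a perturbation of sup norm at most
`a`. -/
theorem excess_add_le (g h : Ω →ₘ[μ] 𝕜) {a : ℝ≥0∞} (ha : eLpNorm h ∞ μ ≤ a) :
    excess (g + h) a ≤ eLpNorm g 1 μ := by
  rw [eLpNorm_one_eq_lintegral_enorm, excess]
  refine lintegral_mono_ae ?_
  rw [eLpNorm_exponent_top] at ha
  filter_upwards [AEEqFun.coeFn_add g h, ae_le_eLpNormEssSup (f := h) (μ := μ)] with x hx hh
  rw [hx, tsub_le_iff_right, Pi.add_apply]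
  exact (enorm_add_le _ _).trans (by gcongr; exact hh.trans ha)

theorem exists_excess_ne_top {f : Ω →ₘ[μ] 𝕜} (hf : f ∈ L1AddLinf 𝕜 μ) :
    ∃ a : ℝ≥0∞, a ≠ ∞ ∧ excess f a ≠ ∞ := by
  obtain ⟨g, hg, h, hh, rfl⟩ := Submodule.mem_sup.1 hf
  exact ⟨eLpNorm h ∞ μ, (mem_LpSubmodule_iff.1 hh).ne,
    ((excess_add_le g h le_rfl).trans_lt (mem_LpSubmodule_iff.1 hg)).ne⟩

/-- Split `f` at height `a`. The image of the clipped part stays below `a`, and the image of the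
remainder has `L¹` norm at most the excess of `f`. -/
theorem IsDunfordSchwartz.excess_le {T : Module.End 𝕜 (L1AddLinf 𝕜 μ)} (hT : IsDunfordSchwartz T)
    (f : L1AddLinf 𝕜 μ) {a : ℝ≥0∞} (ha : a ≠ ∞) :
    excess (T f : Ω →ₘ[μ] 𝕜) a ≤ excess (f : Ω →ₘ[μ] 𝕜) a := by
  obtain ⟨f, hf⟩ := f
  by_cases h : excess f a = ∞
  · exact le_top.trans_eq h.symm
  lift a to NNReal using ha
  rw [← ENNReal.ofReal_coe_nnreal] at h ⊢
  have hu := sub_clipAE_mem_L1 a.coe_nonneg h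
  have hv := clipAE_mem_Linf a.coe_nonneg f
  have huv : (⟨f, hf⟩ : L1AddLinf 𝕜 μ) = ⟨f - clipAE a f, L1_le hu⟩ + ⟨clipAE a f, Linf_le hv⟩ :=
    Subtype.ext (sub_add_cancel f (clipAE a f)).symm
  rw [huv, map_add, Submodule.coe_add]
  refine (excess_add_le _ _ ((hT.2 ⟨clipAE a f, Linf_le hv⟩ hv).trans
    (eLpNorm_top_clipAE_le a.coe_nonneg f))).trans ?_
  refine (hT.1 ⟨f - clipAE a f, L1_le hu⟩ hu).trans ?_
  rw [← huv]
  exact (eLpNorm_one_sub_clipAE a.coe_nonneg f).le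

/-! ### Ergodic averages -/

theorem eLpNorm_sum_coe_le {ι : Type*} (s : Finset ι) (v : ι → Ω →ₘ[μ] 𝕜) {p : ℝ≥0∞}
    (hp : 1 ≤ p) : eLpNorm (∑ i ∈ s, v i : Ω →ₘ[μ] 𝕜) p μ ≤ ∑ i ∈ s, eLpNorm (v i) p μ := by
  classical
  induction s using Finset.induction_on with
  | empty =>
    rw [Finset.sum_empty, Finset.sum_empty, eLpNorm_congr_ae AEEqFun.coeFn_zero]
    simp
  | insert i s hi ih =>
    rw [Finset.sum_insert hi, Finset.sum_insert hi, eLpNorm_congr_ae (AEEqFun.coeFn_add _ _)]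
    exact (eLpNorm_add_le (AEEqFun.aestronglyMeasurable _) (AEEqFun.aestronglyMeasurable _)
      hp).trans (by gcongr)

theorem eLpNorm_average_le (n : ℕ) (v : ℕ → Ω →ₘ[μ] 𝕜) {p C : ℝ≥0∞} (hp : 1 ≤ p)
    (hv : ∀ k, eLpNorm (v k) p μ ≤ C) :
    eLpNorm ((n : 𝕜)⁻¹ • ∑ k ∈ Finset.range n, v k : Ω →ₘ[μ] 𝕜) p μ ≤ C := by
  rw [eLpNorm_congr_ae (AEEqFun.coeFn_smul _ _), eLpNorm_const_smul]
  have h1 : eLpNorm (∑ k ∈ Finset.range n, v k : Ω →ₘ[μ] 𝕜) p μ ≤ n * C :=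
    (eLpNorm_sum_coe_le _ _ hp).trans
      ((Finset.sum_le_sum fun k _ => hv k).trans_eq (by simp))
  rcases Nat.eq_zero_or_pos n with rfl | hn
  · simp
  calc ‖(n : 𝕜)⁻¹‖ₑ * eLpNorm (∑ k ∈ Finset.range n, v k : Ω →ₘ[μ] 𝕜) p μ
      ≤ (n : ℝ≥0∞)⁻¹ * (n * C) := by
        gcongr
        rw [← ofReal_norm, norm_inv, RCLike.norm_natCast, ENNReal.ofReal_inv_of_pos (by positivity),
          ENNReal.ofReal_natCast]
    _ = C := by
        rw [← mul_assoc, ENNReal.inv_mul_cancel (by simpa using hn.ne') (by simp), one_mul]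

theorem eLpNorm_pow_le {T : Module.End 𝕜 (L1AddLinf 𝕜 μ)} {p : ℝ≥0∞}
    (hT : ∀ f : L1AddLinf 𝕜 μ, (f : Ω →ₘ[μ] 𝕜) ∈ Lp.LpSubmodule 𝕜 𝕜 p μ →
      eLpNorm (T f : Ω →ₘ[μ] 𝕜) p μ ≤ eLpNorm (f : Ω →ₘ[μ] 𝕜) p μ)
    (f : L1AddLinf 𝕜 μ) (hf : (f : Ω →ₘ[μ] 𝕜) ∈ Lp.LpSubmodule 𝕜 𝕜 p μ) (n : ℕ) :
    eLpNorm ((T ^ n) f : Ω →ₘ[μ] 𝕜) p μ ≤ eLpNorm (f : Ω →ₘ[μ] 𝕜) p μ := by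
  induction n with
  | zero => simp
  | succ n ih =>
    rw [pow_succ', Module.End.mul_apply]
    exact (hT _ (mem_LpSubmodule_iff.2 (ih.trans_lt (mem_LpSubmodule_iff.1 hf)))).trans ih

/-- The `n`-th ergodic average as an operator. -/
def averageOp (T : Module.End 𝕜 (L1AddLinf 𝕜 μ)) (n : ℕ) : Module.End 𝕜 (L1AddLinf 𝕜 μ) :=
  (n : 𝕜)⁻¹ • ∑ k ∈ Finset.range n, T ^ k

theorem averageOp_apply (T : Module.End 𝕜 (L1AddLinf 𝕜 μ)) (n : ℕ) (f : L1AddLinf 𝕜 μ) :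
    averageOp T n f = ergodicAverage T n f := by
  simp [averageOp, ergodicAverage]

theorem coe_averageOp (T : Module.End 𝕜 (L1AddLinf 𝕜 μ)) (n : ℕ) (f : L1AddLinf 𝕜 μ) :
    (averageOp T n f : Ω →ₘ[μ] 𝕜) =
      (n : 𝕜)⁻¹ • ∑ k ∈ Finset.range n, ((T ^ k) f : Ω →ₘ[μ] 𝕜) := by
  simp [averageOp]

theorem IsDunfordSchwartz.average {T : Module.End 𝕜 (L1AddLinf 𝕜 μ)}
    (hT : IsDunfordSchwartz T) (n : ℕ) : IsDunfordSchwartz (averageOp T n) := by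
  constructor
  · intro f hf
    rw [coe_averageOp]
    exact eLpNorm_average_le n _ le_rfl (eLpNorm_pow_le hT.1 f hf)
  · intro f hf
    rw [coe_averageOp]
    exact eLpNorm_average_le n _ le_top (eLpNorm_pow_le hT.2 f hf)

/-! ### Submajorization in terms of excesses -/

/-- Realizes a value of a distribution function as the length of a set of times, so that
inequalities between distribution functions reduce to inclusions. -/
theorem volume_pos_ofReal_lt (d : ℝ≥0∞) :
    volume {t : ℝ | 0 < t ∧ ENNReal.ofReal t < d} = d := by
  rcases eq_or_ne d ∞ with rfl | hd
  · have : {t : ℝ | 0 < t ∧ ENNReal.ofReal t < ∞} = Set.Ioi 0 := by ext; simp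
    rw [this, Real.volume_Ioi]
  · have : {t : ℝ | 0 < t ∧ ENNReal.ofReal t < d} = Set.Ioo 0 d.toReal := by
      ext t
      simp only [Set.mem_ofPred_eq, Set.mem_Ioo]
      exact and_congr_right fun ht => ENNReal.ofReal_lt_iff_lt_toReal ht.le hd
    rw [this, Real.volume_Ioo, sub_zero, ENNReal.ofReal_toReal hd]

theorem rearrangement_antitone (f : Ω →ₘ[μ] 𝕜) : Antitone (rearrangement f) := fun _ _ h =>
  sInf_le_sInf fun _ hl => ⟨hl.1, hl.2.trans (ENNReal.ofReal_le_ofReal h)⟩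

theorem ofReal_lt_measure_of_lt_rearrangement {f : Ω →ₘ[μ] 𝕜} {t : ℝ} {l : ℝ≥0∞} (hl : 0 < l)
    (h : l < rearrangement f t) : ENNReal.ofReal t < μ {x | l < ‖f x‖ₑ} :=
  not_le.1 fun h' => h.not_ge (sInf_le ⟨hl, h'⟩)

theorem le_rearrangement_of_ofReal_lt_measure {f : Ω →ₘ[μ] 𝕜} {t : ℝ} {l : ℝ≥0∞}
    (h : ENNReal.ofReal t < μ {x | l < ‖f x‖ₑ}) : l ≤ rearrangement f t := by
  refine le_sInf fun l' hl' => le_of_not_gt fun hlt => ?_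
  exact (h.trans_le (measure_mono fun x (hx : l < _) => hlt.trans hx)).not_ge hl'.2

theorem measure_le_ofReal_of_rearrangement_lt {f : Ω →ₘ[μ] 𝕜} {t : ℝ} {l : ℝ≥0∞}
    (h : rearrangement f t < l) : μ {x | l < ‖f x‖ₑ} ≤ ENNReal.ofReal t :=
  not_lt.1 fun h' => h.not_ge (le_rearrangement_of_ofReal_lt_measure h')

theorem aemeasurable_enorm_sub (f : Ω →ₘ[μ] 𝕜) (a : ℝ≥0∞) :
    AEMeasurable (fun x => ‖f x‖ₑ - a) μ :=
  f.aestronglyMeasurable.enorm.sub aemeasurable_const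

/-- On `(0, s)` the part of the rearrangement below `a` contributes at most `a * s`; the part above
is controlled by the excess, since `g` and its rearrangement have comparable distribution functions.
-/
theorem lintegral_rearrangement_le (g : Ω →ₘ[μ] 𝕜) {s : ℝ} (a : ℝ≥0∞) :
    ∫⁻ t in Set.Ioo 0 s, rearrangement g t ≤ a * ENNReal.ofReal s + excess g a := by
  have hm : Measurable (rearrangement g) := (rearrangement_antitone g).measurable
  calc ∫⁻ t in Set.Ioo 0 s, rearrangement g t
      ≤ ∫⁻ t in Set.Ioo 0 s, (a + (rearrangement g t - a)) :=
        lintegral_mono fun t => le_add_tsub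
    _ = a * ENNReal.ofReal s + ∫⁻ t in Set.Ioo 0 s, (rearrangement g t - a) := by
        rw [lintegral_add_left measurable_const]
        simp
    _ ≤ a * ENNReal.ofReal s + excess g a := by
        gcongr
        refine (lintegral_le_lintegral_measure_ofReal_lt (hm.sub_const a).aemeasurable).trans
          (le_trans ?_ (lintegral_measure_ofReal_le_le_lintegral (aemeasurable_enorm_sub g a)))
        refine setLIntegral_mono' measurableSet_Ioi fun l hl => ?_
        have hl0 : 0 < ENNReal.ofReal l := ENNReal.ofReal_pos.2 hl
        have h1 : μ {x | ENNReal.ofReal l + a < ‖g x‖ₑ} ≤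
            μ {x | ENNReal.ofReal l ≤ ‖g x‖ₑ - a} :=
          measure_mono fun x hx => by
            simp only [Set.mem_ofPred_eq] at hx ⊢
            exact (lt_tsub_iff_right.2 hx).le
        refine le_trans ?_ h1
        rw [Measure.restrict_apply (measurableSet_lt measurable_const (hm.sub_const a)),
          ← volume_pos_ofReal_lt (μ {x | ENNReal.ofReal l + a < ‖g x‖ₑ})]
        refine measure_mono fun t ht => ⟨ht.2.1, ?_⟩
        exact ofReal_lt_measure_of_lt_rearrangement (hl0.trans_le le_self_add)
          (lt_tsub_iff_right.1 ht.1)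

/-- The choice `a = μ_s(f)` is optimal in the preceding bound: the rearrangement is at least `a` on
`(0, s)`, and all of its excess over `a` occurs there. -/
theorem add_excess_le_lintegral_rearrangement (f : Ω →ₘ[μ] 𝕜) {s : ℝ} (hs : 0 < s)
    (hfs : rearrangement f s ≠ ∞) :
    rearrangement f s * ENNReal.ofReal s + excess f (rearrangement f s) ≤
      ∫⁻ t in Set.Ioo 0 s, rearrangement f t := by
  have hm : Measurable (rearrangement f) := (rearrangement_antitone f).measurable
  set a := rearrangement f s with ha
  have h1 : ∫⁻ t in Set.Ioo 0 s, rearrangement f t =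
      a * ENNReal.ofReal s + ∫⁻ t in Set.Ioo 0 s, (rearrangement f t - a) := by
    have : ∫⁻ t in Set.Ioo 0 s, rearrangement f t =
        ∫⁻ t in Set.Ioo 0 s, (a + (rearrangement f t - a)) :=
      setLIntegral_congr_fun measurableSet_Ioo fun t ht =>
        (add_tsub_cancel_of_le (rearrangement_antitone f ht.2.le)).symm
    rw [this, lintegral_add_left measurable_const]
    simp
  rw [h1]
  gcongr
  refine (lintegral_le_lintegral_measure_ofReal_lt (aemeasurable_enorm_sub f a)).trans
    (le_trans ?_ (lintegral_measure_ofReal_le_le_lintegral (hm.sub_const a).aemeasurable))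
  refine setLIntegral_mono' measurableSet_Ioi fun l hl => ?_
  have hl0 : 0 < ENNReal.ofReal l := ENNReal.ofReal_pos.2 hl
  have h2 : {x | ENNReal.ofReal l < ‖f x‖ₑ - a} = {x | ENNReal.ofReal l + a < ‖f x‖ₑ} := by
    ext x; simp only [Set.mem_ofPred_eq, lt_tsub_iff_right]
  rw [h2, Measure.restrict_apply (measurableSet_le measurable_const (hm.sub_const a)),
    ← volume_pos_ofReal_lt (μ {x | ENNReal.ofReal l + a < ‖f x‖ₑ})]
  refine measure_mono fun t ht => ⟨?_, ht.1, ?_⟩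
  · exact ENNReal.le_sub_of_add_le_right hfs (le_rearrangement_of_ofReal_lt_measure ht.2)
  -- Levels strictly above `μ_s(f)` are exceeded on a set of measure at most `s`, so the relevant
  -- times satisfy `t < s`.
  · have h3 : a < ENNReal.ofReal l + a := by
      rw [add_comm]; exact ENNReal.lt_add_right hfs hl0.ne'
    exact (ENNReal.ofReal_lt_ofReal_iff hs).1
      (ht.2.trans_le (measure_le_ofReal_of_rearrangement_lt h3))

theorem submajorized_of_excess_le {f g : Ω →ₘ[μ] 𝕜}
    (h : ∀ a : ℝ≥0∞, a ≠ ∞ → excess g a ≤ excess f a) : Submajorized g f := by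
  intro s hs
  by_cases hfs : rearrangement f s = ∞
  · have : ∫⁻ t in Set.Ioo 0 s, rearrangement f t = ∞ := by
      have h1 : ∫⁻ t in Set.Ioo 0 s, (∞ : ℝ≥0∞) ≤ ∫⁻ t in Set.Ioo 0 s, rearrangement f t :=
        setLIntegral_mono' measurableSet_Ioo fun t ht =>
          hfs.symm.le.trans (rearrangement_antitone f ht.2.le)
      refine top_le_iff.1 (le_trans ?_ h1)
      simp [ENNReal.top_mul, hs]
    simp [this]
  · calc ∫⁻ t in Set.Ioo 0 s, rearrangement g t
        ≤ rearrangement f s * ENNReal.ofReal s + excess g (rearrangement f s) :=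
          lintegral_rearrangement_le g _
      _ ≤ rearrangement f s * ENNReal.ofReal s + excess f (rearrangement f s) := by
          gcongr; exact h _ hfs
      _ ≤ _ := add_excess_le_lintegral_rearrangement f hs hfs

/-! ### The maximal inequality

A filling scheme: at every step, the moving mass that arrives at a point is stored there as long
as the total stored mass does not exceed `a`, and only the overflow is moved on by `T`. -/

/-- The part of `d` that still fits below the level `a` when `c` has been stored. -/
def stored (a : ℝ) (c : Lp ℝ 1 μ) (d : Lp 𝕜 1 μ) : Lp 𝕜 1 μ :=
  MemLp.toLp (fun x => clip (max (a - c x) 0) (d x)) <|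
    (Lp.memLp d).mono
      (measurable_clip.comp_aemeasurable
        (((aemeasurable_const.sub (Lp.aestronglyMeasurable c).aemeasurable).max
          aemeasurable_const).prodMk
            (Lp.aestronglyMeasurable d).aemeasurable)).aestronglyMeasurable
      (Eventually.of_forall fun x => by
        rw [norm_clip (le_max_right _ _)]
        exact min_le_left _ _)

theorem coeFn_stored (a : ℝ) (c : Lp ℝ 1 μ) (d : Lp 𝕜 1 μ) :
    stored a c d =ᵐ[μ] fun x => clip (max (a - c x) 0) (d x) := MemLp.coeFn_toLp _

/-- The absolute value of an integrable function, as an element of `L¹`. -/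
def absLp (f : Lp 𝕜 1 μ) : Lp ℝ 1 μ := (Lp.memLp f).norm.toLp (fun x => ‖f x‖)

theorem coeFn_absLp (f : Lp 𝕜 1 μ) : absLp f =ᵐ[μ] fun x => ‖f x‖ := MemLp.coeFn_toLp _

/-- The filling scheme: the total stored mass and the moving function after `n` steps. -/
def filling (T : Lp 𝕜 1 μ →ₗ[𝕜] Lp 𝕜 1 μ) (a : ℝ) (f : Lp 𝕜 1 μ) : ℕ → Lp ℝ 1 μ × Lp 𝕜 1 μ
  | 0 => (0, f)
  | n + 1 =>
    ((filling T a f n).1 + absLp (stored a (filling T a f n).1 (filling T a f n).2),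
      T ((filling T a f n).2 - stored a (filling T a f n).1 (filling T a f n).2))

section Filling

variable (T : Lp 𝕜 1 μ →ₗ[𝕜] Lp 𝕜 1 μ) (a : ℝ) (f : Lp 𝕜 1 μ)

/-- The function stored in step `n` of the filling scheme. -/
def deposit (n : ℕ) : Lp 𝕜 1 μ := stored a (filling T a f n).1 (filling T a f n).2

/-- The overflow in step `n` of the filling scheme. -/
def overflow (n : ℕ) : Lp 𝕜 1 μ := (filling T a f n).2 - deposit T a f n

/-- The contribution of the deposits of the first `n` steps to `∑_{k<n} T^k f`. -/
def depositSum : ℕ → Lp 𝕜 1 μ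
  | 0 => 0
  | n + 1 => T (depositSum n) + ∑ k ∈ Finset.range (n + 1), deposit T a f k

theorem filling_fst_succ (n : ℕ) :
    (filling T a f (n + 1)).1 = (filling T a f n).1 + absLp (deposit T a f n) := rfl

theorem filling_snd_succ (n : ℕ) : (filling T a f (n + 1)).2 = T (overflow T a f n) := rfl

/-- Each moving function is deposit plus overflow, and `T` sends the overflow of step `k` to the
moving function of step `k + 1`; the identity then follows from `S_{n+1} f = T (S_n f) + f` for `S_n
= ∑_{k<n} T^k`. -/
theorem sum_pow_eq_depositSum_add (n : ℕ) :
    ∑ k ∈ Finset.range n, (T ^ k) f =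
      depositSum T a f n + ∑ k ∈ Finset.range n, overflow T a f k := by
  induction n with
  | zero => simp [depositSum]
  | succ n ih =>
    have h1 : ∑ k ∈ Finset.range (n + 1), (T ^ k) f =
        T (∑ k ∈ Finset.range n, (T ^ k) f) + f := by
      rw [Finset.sum_range_succ', map_sum]
      simp only [pow_succ', Module.End.mul_apply, pow_zero, Module.End.one_apply]
    have h2 : T (∑ k ∈ Finset.range n, overflow T a f k) + f =
        ∑ k ∈ Finset.range (n + 1), (deposit T a f k + overflow T a f k) := by
      have : ∀ k, deposit T a f k + overflow T a f k = (filling T a f k).2 := fun k => by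
        simp [overflow]
      simp only [this]
      rw [Finset.sum_range_succ', map_sum]
      rfl
    rw [h1, ih, map_add, add_assoc, h2, Finset.sum_add_distrib, depositSum, add_assoc]

variable {a}

theorem filling_fst_mem (ha : 0 ≤ a) (n : ℕ) :
    ∀ᵐ x ∂μ, 0 ≤ (filling T a f n).1 x ∧ (filling T a f n).1 x ≤ a := by
  induction n with
  | zero =>
    filter_upwards [AEEqFun.coeFn_zero (β := ℝ) (μ := μ)] with x hx
    simp [filling, hx, ha]
  | succ n ih =>
    filter_upwards [ih, Lp.coeFn_add (filling T a f n).1 (absLp (deposit T a f n)),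
      coeFn_absLp (deposit T a f n), coeFn_stored a (filling T a f n).1 (filling T a f n).2]
      with x hx h1 h2 h3
    rw [filling_fst_succ, h1, Pi.add_apply, h2]
    have h4 : ‖deposit T a f n x‖ ≤ a - (filling T a f n).1 x := by
      rw [deposit, h3, norm_clip (le_max_right _ _)]
      exact (min_le_right _ _).trans (max_le le_rfl (sub_nonneg.2 hx.2))
    exact ⟨add_nonneg hx.1 (norm_nonneg _), by linarith⟩

theorem filling_fst_le_succ (n : ℕ) :
    ∀ᵐ x ∂μ, (filling T a f n).1 x ≤ (filling T a f (n + 1)).1 x := by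
  filter_upwards [Lp.coeFn_add (filling T a f n).1 (absLp (deposit T a f n)),
    coeFn_absLp (deposit T a f n)] with x h1 h2
  rw [filling_fst_succ, h1, Pi.add_apply, h2]
  exact le_add_of_nonneg_right (norm_nonneg _)

theorem norm_sum_deposit_le (n : ℕ) :
    ∀ᵐ x ∂μ, ‖(∑ k ∈ Finset.range n, deposit T a f k : Lp 𝕜 1 μ) x‖ ≤ (filling T a f n).1 x := by
  induction n with
  | zero =>
    filter_upwards [AEEqFun.coeFn_zero (β := ℝ) (μ := μ), AEEqFun.coeFn_zero (β := 𝕜) (μ := μ)] with x hx hx'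
    simp [filling, hx, hx']
  | succ n ih =>
    rw [Finset.sum_range_succ]
    filter_upwards [ih, Lp.coeFn_add (filling T a f n).1 (absLp (deposit T a f n)),
      coeFn_absLp (deposit T a f n),
      Lp.coeFn_add (∑ k ∈ Finset.range n, deposit T a f k) (deposit T a f n)] with x hx h1 h2 h3
    rw [filling_fst_succ, h1, h3, Pi.add_apply, Pi.add_apply, h2]
    exact (norm_add_le _ _).trans (by gcongr)

/-- Overflow occurs only where the clipping is effective, and there the deposit uses up all the
remaining room `a - c`. -/
theorem filling_eq_of_overflow_ne_zero (ha : 0 ≤ a) (n : ℕ) :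
    ∀ᵐ x ∂μ, overflow T a f n x ≠ 0 → (filling T a f (n + 1)).1 x = a := by
  filter_upwards [filling_fst_mem T f ha n,
    Lp.coeFn_add (filling T a f n).1 (absLp (deposit T a f n)),
    Lp.coeFn_sub (filling T a f n).2 (deposit T a f n),
    coeFn_absLp (deposit T a f n), coeFn_stored a (filling T a f n).1 (filling T a f n).2]
    with x hx h1 h2 h3 h4 hne
  rw [filling_fst_succ, h1, Pi.add_apply, h3, deposit, h4, norm_clip (le_max_right _ _),
    max_eq_left (sub_nonneg.2 hx.2)]
  rw [overflow, h2, Pi.sub_apply, deposit, h4, ← norm_pos_iff, norm_sub_clip (le_max_right _ _),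
    max_eq_left (sub_nonneg.2 hx.2)] at hne
  rcases le_total ‖(filling T a f n).2 x‖ (a - (filling T a f n).1 x) with h | h
  · rw [min_eq_left h] at hne
    simp at hne
  · rw [min_eq_right h]
    ring

/-- Clipping splits a scalar into two nonnegative multiples of itself, so the absolute values add
without loss. -/
theorem norm_deposit_add_norm_overflow (n : ℕ) :
    ‖deposit T a f n‖ + ‖overflow T a f n‖ = ‖(filling T a f n).2‖ := by
  simp only [L1.norm_eq_integral_norm]
  rw [← integral_add (L1.integrable_coeFn _).norm (L1.integrable_coeFn _).norm]
  refine integral_congr_ae ?_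
  filter_upwards [Lp.coeFn_sub (filling T a f n).2 (deposit T a f n),
    coeFn_stored a (filling T a f n).1 (filling T a f n).2] with x h2 h4
  rw [overflow, h2, Pi.sub_apply, deposit, h4, norm_clip (le_max_right _ _),
    norm_sub_clip (le_max_right _ _)]
  ring

theorem norm_absLp (g : Lp 𝕜 1 μ) : ‖absLp g‖ = ‖g‖ := by
  simp only [L1.norm_eq_integral_norm]
  refine integral_congr_ae ?_
  filter_upwards [coeFn_absLp g] with x hx
  rw [hx, norm_norm]

variable {T}

/-- Mass balance: deposits only move mass from the moving to the stored part, and `T` creates none.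
-/
theorem norm_filling_le (hT : ∀ g, ‖T g‖ ≤ ‖g‖) (n : ℕ) :
    ‖(filling T a f n).1‖ + ‖(filling T a f n).2‖ ≤ ‖f‖ := by
  induction n with
  | zero => simp [filling]
  | succ n ih =>
    have h1 : ‖(filling T a f (n + 1)).1‖ ≤ ‖(filling T a f n).1‖ + ‖deposit T a f n‖ := by
      rw [filling_fst_succ, ← norm_absLp (deposit T a f n)]
      exact norm_add_le _ _
    have h2 : ‖(filling T a f (n + 1)).2‖ ≤ ‖overflow T a f n‖ := by
      rw [filling_snd_succ]; exact hT _
    linarith [norm_deposit_add_norm_overflow T f (a := a) n]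

/-- Unwinding the recursion gives `n` terms `T^(n-j) (∑_{k<j} deposit k)`. Each partial sum of
deposits is dominated by the stored mass, hence by `a`, and `T` preserves this uniform bound. -/
theorem norm_depositSum_le (ha : 0 ≤ a)
    (hT : ∀ (g : Lp 𝕜 1 μ) (C : ℝ), 0 ≤ C → (∀ᵐ x ∂μ, ‖g x‖ ≤ C) → ∀ᵐ x ∂μ, ‖T g x‖ ≤ C) (n : ℕ) :
    ∀ᵐ x ∂μ, ‖depositSum T a f n x‖ ≤ n * a := by
  induction n with
  | zero =>
    filter_upwards [AEEqFun.coeFn_zero (β := 𝕜) (μ := μ)] with x hx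
    simp [depositSum, hx]
  | succ n ih =>
    filter_upwards [hT _ _ (by positivity) ih, norm_sum_deposit_le T f (a := a) (n + 1),
      filling_fst_mem T f ha (n + 1), Lp.coeFn_add (T (depositSum T a f n))
        (∑ k ∈ Finset.range (n + 1), deposit T a f k)] with x h1 h2 h3 h4
    rw [depositSum, h4, Pi.add_apply]
    refine (norm_add_le _ _).trans ?_
    rw [Nat.cast_succ]
    linarith [h3.2]

theorem measure_le_filling (hT : ∀ g, ‖T g‖ ≤ ‖g‖) (ha : 0 < a) (n : ℕ) :
    μ {x | a ≤ (filling T a f n).1 x} ≤ ‖f‖ₑ / ENNReal.ofReal a := by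
  have h0 : ENNReal.ofReal a ≠ 0 := by simpa using ha
  have h1 : μ {x | a ≤ (filling T a f n).1 x} ≤
      μ {x | ENNReal.ofReal a ≤ ‖(filling T a f n).1 x‖ₑ} := by
    refine measure_mono fun x hx => ?_
    simp only [Set.mem_ofPred_eq] at hx ⊢
    rw [← ofReal_norm]
    exact ENNReal.ofReal_le_ofReal (hx.trans (le_abs_self _))
  refine h1.trans ((meas_ge_le_lintegral_div
    (Lp.aestronglyMeasurable _).enorm h0 ENNReal.ofReal_ne_top).trans ?_)
  gcongr
  rw [← eLpNorm_one_eq_lintegral_enorm, ← Lp.enorm_def, ← ofReal_norm, ← ofReal_norm]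
  exact ENNReal.ofReal_le_ofReal
    ((le_add_of_nonneg_right (norm_nonneg _)).trans (norm_filling_le f hT n))

/-- The **maximal ergodic inequality** for contractions of `L¹` which contract the uniform norm,
positive or not. -/
theorem measure_exists_lt_norm_sum_pow_le (hT : ∀ g, ‖T g‖ ≤ ‖g‖)
    (hT' : ∀ (g : Lp 𝕜 1 μ) (C : ℝ), 0 ≤ C → (∀ᵐ x ∂μ, ‖g x‖ ≤ C) → ∀ᵐ x ∂μ, ‖T g x‖ ≤ C)
    (ha : 0 < a) :
    μ {x | ∃ n : ℕ, n * a < ‖(∑ k ∈ Finset.range n, (T ^ k) f : Lp 𝕜 1 μ) x‖} ≤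
      ‖f‖ₑ / ENNReal.ofReal a := by
  let A : ℕ → Set Ω := fun N =>
    {x | ∃ n ≤ N, n * a < ‖(∑ k ∈ Finset.range n, (T ^ k) f : Lp 𝕜 1 μ) x‖}
  have hA : {x | ∃ n : ℕ, n * a < ‖(∑ k ∈ Finset.range n, (T ^ k) f : Lp 𝕜 1 μ) x‖} =
      ⋃ N, A N := by
    ext x
    simp only [Set.mem_ofPred_eq, Set.mem_iUnion, A]
    exact ⟨fun ⟨n, hn⟩ => ⟨n, n, le_rfl, hn⟩, fun ⟨_, n, _, hn⟩ => ⟨n, hn⟩⟩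
  have hmono : Monotone A := fun N M hNM x ⟨n, hn, h⟩ => ⟨n, hn.trans hNM, h⟩
  rw [hA, hmono.measure_iUnion]
  -- At a point not full after `N` steps there has been no overflow before step `N`, so for `n ≤ N`
  -- the orbit sum equals its deposit part and is at most `n * a`.
  refine iSup_le fun N => le_trans (measure_mono_ae ?_) (measure_le_filling f hT ha N)
  have hsum : ∀ n : ℕ, ∀ᵐ x ∂μ, (∀ k < n, overflow T a f k x = 0) →
      (∑ k ∈ Finset.range n, overflow T a f k : Lp 𝕜 1 μ) x = 0 := fun n => by
    induction n with
    | zero =>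
      filter_upwards [Lp.coeFn_zero 𝕜 1 μ] with x hx _
      simpa using hx
    | succ n ih =>
      rw [Finset.sum_range_succ]
      filter_upwards [ih, Lp.coeFn_add (∑ k ∈ Finset.range n, overflow T a f k)
        (overflow T a f n)] with x h1 h2 h3
      rw [h2, Pi.add_apply, h1 fun k hk => h3 k (hk.trans n.lt_succ_self), h3 n n.lt_succ_self,
        add_zero]
  filter_upwards [ae_all_iff.2 hsum, ae_all_iff.2 (norm_depositSum_le f ha.le hT'),
    ae_all_iff.2 (filling_eq_of_overflow_ne_zero T f ha.le),
    ae_all_iff.2 (filling_fst_le_succ T f (a := a)),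
    ae_all_iff.2 fun n => Lp.coeFn_add (depositSum T a f n)
      (∑ k ∈ Finset.range n, overflow T a f k)] with x h1 h2 h3 h4 h5 hx
  obtain ⟨n, hn, hlt⟩ := hx
  rw [sum_pow_eq_depositSum_add T a, h5 n, Pi.add_apply] at hlt
  by_contra hc
  refine hlt.not_ge ?_
  rw [h1 n, add_zero]
  · exact h2 n
  · intro k hk
    by_contra hne
    have hmon : Monotone fun n => (filling T a f n).1 x := monotone_nat_of_le_succ h4
    exact hc ((h3 k hne).symm.le.trans (hmon (Nat.succ_le_of_lt (hk.trans_le hn))))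

end Filling

/-! ### Restrictions of operators to `L^p` -/

/-- The restriction to `L^p` of an operator on `L¹ + L^∞`. -/
def restrictLp (T : Module.End 𝕜 (L1AddLinf 𝕜 μ)) {p : ℝ≥0∞}
    (hp : Lp.LpSubmodule 𝕜 𝕜 p μ ≤ L1AddLinf 𝕜 μ)
    (hT : ∀ f : L1AddLinf 𝕜 μ, (f : Ω →ₘ[μ] 𝕜) ∈ Lp.LpSubmodule 𝕜 𝕜 p μ →
      eLpNorm (T f : Ω →ₘ[μ] 𝕜) p μ ≤ eLpNorm (f : Ω →ₘ[μ] 𝕜) p μ) :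
    Lp 𝕜 p μ →ₗ[𝕜] Lp 𝕜 p μ where
  toFun f := ⟨T ⟨f, hp f.2⟩, (hT ⟨f, hp f.2⟩ f.2).trans_lt f.2⟩
  map_add' f g := by
    have h := congrArg Subtype.val (T.map_add ⟨f, hp f.2⟩ ⟨g, hp g.2⟩)
    exact Subtype.ext h
  map_smul' c f := by
    have h := congrArg Subtype.val (T.map_smul c ⟨f, hp f.2⟩)
    exact Subtype.ext h

section Restrict

variable {T : Module.End 𝕜 (L1AddLinf 𝕜 μ)} {p : ℝ≥0∞}
  (hp : Lp.LpSubmodule 𝕜 𝕜 p μ ≤ L1AddLinf 𝕜 μ)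
  (hT : ∀ f : L1AddLinf 𝕜 μ, (f : Ω →ₘ[μ] 𝕜) ∈ Lp.LpSubmodule 𝕜 𝕜 p μ →
    eLpNorm (T f : Ω →ₘ[μ] 𝕜) p μ ≤ eLpNorm (f : Ω →ₘ[μ] 𝕜) p μ)

theorem coe_restrictLp (f : Lp 𝕜 p μ) :
    (restrictLp T hp hT f : Ω →ₘ[μ] 𝕜) = T ⟨f, hp f.2⟩ := rfl

theorem coe_restrictLp_pow (f : Lp 𝕜 p μ) (n : ℕ) :
    ((restrictLp T hp hT ^ n) f : Ω →ₘ[μ] 𝕜) = (T ^ n) ⟨f, hp f.2⟩ := by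
  induction n with
  | zero => rfl
  | succ n ih =>
    rw [pow_succ', Module.End.mul_apply, pow_succ', Module.End.mul_apply, coe_restrictLp]
    congr 2
    exact Subtype.ext ih

theorem norm_restrictLp_le (f : Lp 𝕜 p μ) : ‖restrictLp T hp hT f‖ ≤ ‖f‖ := by
  rw [Lp.norm_def, Lp.norm_def]
  exact ENNReal.toReal_mono (Lp.eLpNorm_ne_top f) (hT ⟨f, hp f.2⟩ f.2)

end Restrict

theorem coe_averageOp_eq_smul_sum {T : Module.End 𝕜 (L1AddLinf 𝕜 μ)} {p : ℝ≥0∞}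
    (hp : Lp.LpSubmodule 𝕜 𝕜 p μ ≤ L1AddLinf 𝕜 μ)
    (hT : ∀ f : L1AddLinf 𝕜 μ, (f : Ω →ₘ[μ] 𝕜) ∈ Lp.LpSubmodule 𝕜 𝕜 p μ →
      eLpNorm (T f : Ω →ₘ[μ] 𝕜) p μ ≤ eLpNorm (f : Ω →ₘ[μ] 𝕜) p μ) (f : Lp 𝕜 p μ) (n : ℕ) :
    (averageOp T n ⟨f, hp f.2⟩ : Ω →ₘ[μ] 𝕜) =
      (n : 𝕜)⁻¹ • ((∑ k ∈ Finset.range n, (restrictLp T hp hT ^ k) f : Lp 𝕜 p μ) :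
        Ω →ₘ[μ] 𝕜) := by
  rw [coe_averageOp, AddSubgroup.val_finsetSum]
  simp only [coe_restrictLp_pow]

theorem eLpNorm_top_le_ofReal_iff {f : Ω →ₘ[μ] 𝕜} {C : ℝ} (hC : 0 ≤ C) :
    eLpNorm f ∞ μ ≤ ENNReal.ofReal C ↔ ∀ᵐ x ∂μ, ‖f x‖ ≤ C := by
  have : ∀ x, ‖f x‖ₑ ≤ ENNReal.ofReal C ↔ ‖f x‖ ≤ C := fun x => by
    rw [← ofReal_norm, ENNReal.ofReal_le_ofReal_iff hC]
  rw [eLpNorm_exponent_top]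
  refine ⟨fun h => ?_, fun h => ?_⟩
  · filter_upwards [ae_le_eLpNormEssSup (f := f) (μ := μ)] with x hx
    exact (this x).1 (hx.trans h)
  · refine essSup_le_of_ae_le _ ?_
    filter_upwards [h] with x hx
    exact (this x).2 hx

/-- The maximal ergodic inequality for Dunford–Schwartz operators on `L¹ + L^∞`. -/
theorem IsDunfordSchwartz.measure_exists_lt_norm_average_le {T : Module.End 𝕜 (L1AddLinf 𝕜 μ)}
    (hT : IsDunfordSchwartz T) (f : L1AddLinf 𝕜 μ) {a : ℝ} (ha : 0 < a) :
    μ {x | ∃ n : ℕ, 2 * a < ‖(averageOp T n f : Ω →ₘ[μ] 𝕜) x‖} ≤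
      excess (f : Ω →ₘ[μ] 𝕜) (ENNReal.ofReal a) / ENNReal.ofReal a := by
  obtain ⟨f, hf⟩ := f
  by_cases h : excess f (ENNReal.ofReal a) = ∞
  · simp [h, ENNReal.top_div]
  have hu := sub_clipAE_mem_L1 ha.le h
  have hv := clipAE_mem_Linf ha.le f
  let u : Lp 𝕜 1 μ := ⟨f - clipAE a f, hu⟩
  have huv : (⟨f, hf⟩ : L1AddLinf 𝕜 μ) = ⟨u, L1_le u.2⟩ + ⟨clipAE a f, Linf_le hv⟩ :=
    Subtype.ext (sub_add_cancel f (clipAE a f)).symm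
  have hmax := measure_exists_lt_norm_sum_pow_le (T := restrictLp T L1_le hT.1) u
    (norm_restrictLp_le L1_le hT.1) (fun g C hC hg => by
      rw [← eLpNorm_top_le_ofReal_iff hC] at hg ⊢
      exact (hT.2 ⟨g, L1_le g.2⟩ (mem_LpSubmodule_iff.2 (hg.trans_lt ENNReal.ofReal_lt_top))).trans
        hg) ha
  have hnorm : ‖u‖ₑ = excess f (ENNReal.ofReal a) := by
    rw [Lp.enorm_def]
    exact eLpNorm_one_sub_clipAE ha.le f
  rw [hnorm] at hmax
  refine le_trans (measure_mono_ae ?_) hmax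
  -- The threshold `2 * a` is shared: averages of the clipped part take at most `a`, so those of the
  -- integrable part must exceed `a`.
  have hbd : ∀ n : ℕ, ∀ᵐ x ∂μ,
      ‖(averageOp T n ⟨clipAE a f, Linf_le hv⟩ : Ω →ₘ[μ] 𝕜) x‖ ≤ a := fun n =>
    (eLpNorm_top_le_ofReal_iff ha.le).1
      (((hT.average n).2 ⟨clipAE a f, Linf_le hv⟩ hv).trans (eLpNorm_top_clipAE_le ha.le f))
  filter_upwards [ae_all_iff.2 hbd,
    ae_all_iff.2 fun n => AEEqFun.coeFn_add (averageOp T n ⟨u, L1_le u.2⟩ : Ω →ₘ[μ] 𝕜)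
      (averageOp T n ⟨clipAE a f, Linf_le hv⟩ : Ω →ₘ[μ] 𝕜),
    ae_all_iff.2 fun n : ℕ => AEEqFun.coeFn_smul ((n : 𝕜)⁻¹)
      ((∑ k ∈ Finset.range n, (restrictLp T L1_le hT.1 ^ k) u : Lp 𝕜 1 μ) : Ω →ₘ[μ] 𝕜)]
    with x h1 h2 h3 hx
  obtain ⟨n, hn⟩ := hx
  refine ⟨n, ?_⟩
  rw [huv, map_add, Submodule.coe_add, h2 n, Pi.add_apply,
    coe_averageOp_eq_smul_sum L1_le hT.1, h3 n, Pi.smul_apply] at hn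
  have h4 := (hn.trans_le (norm_add_le _ _)).trans_le (add_le_add_right (h1 n) _)
  rw [norm_smul, norm_inv, RCLike.norm_natCast] at h4
  -- The average of index `0` vanishes because `0⁻¹ = 0`, so it never exceeds the threshold.
  rcases Nat.eq_zero_or_pos n with rfl | hn0
  · norm_num at h4
    linarith
  · have hn0' : (0 : ℝ) < n := by exact_mod_cast hn0
    have h5 := lt_of_add_lt_add_right ((two_mul a).symm.trans_lt h4)
    rwa [inv_mul_eq_div, lt_div_iff₀ hn0', mul_comm] at h5

/-! ### Contractivity in `L²` -/

theorem excess_ofReal_eq_lintegral_Ioi (f : Ω →ₘ[μ] 𝕜) {a : ℝ} (ha : 0 ≤ a) :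
    excess f (ENNReal.ofReal a) = ∫⁻ l in Set.Ioi a, μ {x | l < ‖f x‖} := by
  have hanti : Antitone fun l : ℝ => μ {x | l < ‖f x‖} := fun l l' h =>
    measure_mono fun x (hx : l' < _) => h.trans_lt hx
  have h1 : excess f (ENNReal.ofReal a) = ∫⁻ x, ENNReal.ofReal (max (‖f x‖ - a) 0) ∂μ := by
    refine lintegral_congr fun x => ?_
    rw [← ofReal_norm, ← ENNReal.ofReal_sub _ ha, ENNReal.ofReal_max]
    simp
  have h2 := (measurePreserving_add_left volume a).setLIntegral_comp_preimage
    (measurableSet_Ioi (a := a)) hanti.measurable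
  rw [Set.preimage_const_add_Ioi, sub_self] at h2
  rw [h1, ← h2, lintegral_eq_lintegral_meas_lt μ (f := fun x => max (‖f x‖ - a) 0)
    (Eventually.of_forall fun x => le_max_right _ _)
    ((f.aestronglyMeasurable.norm.aemeasurable.sub_const a).max aemeasurable_const)]
  refine setLIntegral_congr_fun measurableSet_Ioi fun l hl => ?_
  congr 1
  ext x
  have hl' : 0 < l := hl
  simp only [Set.mem_ofPred_eq, lt_max_iff, hl'.not_gt, or_false, lt_sub_iff_add_lt']

/-- Write the excess as `∫_a^∞ μ {|f| > l} dl` and apply Tonelli: the inner integral in `a` produces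
the weight `l` of the layer cake formula for the square. Only two Lebesgue integrals are swapped, so
`μ` need not be σ-finite. -/
theorem lintegral_enorm_sq_eq (f : Ω →ₘ[μ] 𝕜) :
    ∫⁻ x, ‖f x‖ₑ ^ (2 : ℝ) ∂μ = 2 * ∫⁻ a in Set.Ioi (0 : ℝ), excess f (ENNReal.ofReal a) := by
  have hanti : Antitone fun l : ℝ => μ {x | l < ‖f x‖} := fun l l' h =>
    measure_mono fun x (hx : l' < _) => h.trans_lt hx
  have h1 : ∫⁻ x, ‖f x‖ₑ ^ (2 : ℝ) ∂μ = ∫⁻ x, ENNReal.ofReal (‖f x‖ ^ (2 : ℝ)) ∂μ := by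
    refine lintegral_congr fun x => ?_
    rw [← ofReal_norm, ENNReal.ofReal_rpow_of_nonneg (norm_nonneg _) (by norm_num)]
  have h2 : ∫⁻ a in Set.Ioi (0 : ℝ), excess f (ENNReal.ofReal a) =
      ∫⁻ a, ∫⁻ l, (if 0 < a ∧ a < l then μ {x | l < ‖f x‖} else 0) := by
    rw [← lintegral_indicator measurableSet_Ioi]
    refine lintegral_congr fun a => ?_
    by_cases ha : 0 < a
    · rw [Set.indicator_of_mem (by exact ha), excess_ofReal_eq_lintegral_Ioi f ha.le,
        ← lintegral_indicator measurableSet_Ioi]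
      refine lintegral_congr fun l => ?_
      simp [Set.indicator_apply, ha]
    · rw [Set.indicator_of_notMem (by exact ha)]
      simp [ha]
  have hmeas : Measurable fun q : ℝ × ℝ => if 0 < q.1 ∧ q.1 < q.2 then μ {x | q.2 < ‖f x‖} else 0 :=
    Measurable.ite ((measurableSet_lt measurable_const measurable_fst).inter
      (measurableSet_lt measurable_fst measurable_snd)) (hanti.measurable.comp measurable_snd)
      measurable_const
  have h3 : ∀ l : ℝ, ∫⁻ a, (if 0 < a ∧ a < l then μ {x | l < ‖f x‖} else 0) =
      (Set.Ioi (0 : ℝ)).indicator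
        (fun l => μ {x | l < ‖f x‖} * ENNReal.ofReal (l ^ ((2 : ℝ) - 1))) l := fun l => by
    have : (fun a => if 0 < a ∧ a < l then μ {x | l < ‖f x‖} else 0) =
        (Set.Ioo 0 l).indicator fun _ => μ {x | l < ‖f x‖} := by
      ext a
      simp [Set.indicator_apply]
    rw [this, lintegral_indicator_const measurableSet_Ioo, Real.volume_Ioo]
    norm_num
    by_cases hl : 0 < l
    · rw [Set.indicator_of_mem (by exact hl)]
    · rw [Set.indicator_of_notMem (by exact hl), ENNReal.ofReal_of_nonpos (not_lt.1 hl), mul_zero]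
  rw [h1, lintegral_rpow_eq_lintegral_meas_lt_mul μ (Eventually.of_forall fun x => norm_nonneg _)
    f.aestronglyMeasurable.norm.aemeasurable two_pos, h2,
    lintegral_lintegral_swap (by exact hmeas.aemeasurable)]
  simp only [h3]
  rw [lintegral_indicator measurableSet_Ioi, ENNReal.ofReal_ofNat]

theorem eLpNorm_two_eq (f : Ω →ₘ[μ] 𝕜) :
    eLpNorm f 2 μ = (∫⁻ x, ‖f x‖ₑ ^ (2 : ℝ) ∂μ) ^ (1 / 2 : ℝ) := by
  rw [eLpNorm_eq_lintegral_rpow_enorm_toReal two_ne_zero ENNReal.ofNat_ne_top,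
    ENNReal.toReal_ofNat]

theorem eLpNorm_two_sq (f : Ω →ₘ[μ] 𝕜) :
    eLpNorm f 2 μ ^ 2 = ∫⁻ x, ‖f x‖ₑ ^ (2 : ℝ) ∂μ := by
  rw [eLpNorm_two_eq, ← ENNReal.rpow_natCast, ← ENNReal.rpow_mul]
  norm_num

theorem IsDunfordSchwartz.eLpNorm_two_le {T : Module.End 𝕜 (L1AddLinf 𝕜 μ)}
    (hT : IsDunfordSchwartz T) (f : L1AddLinf 𝕜 μ) :
    eLpNorm (T f : Ω →ₘ[μ] 𝕜) 2 μ ≤ eLpNorm (f : Ω →ₘ[μ] 𝕜) 2 μ := by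
  rw [eLpNorm_two_eq, eLpNorm_two_eq, lintegral_enorm_sq_eq, lintegral_enorm_sq_eq]
  gcongr
  exact hT.excess_le f ENNReal.ofReal_ne_top

theorem mul_excess_le (f : Ω →ₘ[μ] 𝕜) (a : ℝ≥0∞) : a * excess f a ≤ eLpNorm f 2 μ ^ 2 := by
  rw [eLpNorm_two_sq, excess, ← lintegral_const_mul'' _ (aemeasurable_enorm_sub f a)]
  refine lintegral_mono fun x => ?_
  rw [ENNReal.rpow_two, sq]
  rcases le_total ‖f x‖ₑ a with h | h
  · simp [tsub_eq_zero_of_le h]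
  · exact mul_le_mul' h tsub_le_self

theorem L2_le : Lp.LpSubmodule 𝕜 𝕜 2 μ ≤ L1AddLinf 𝕜 μ := fun f hf =>
  mem_L1AddLinf_of_excess_ne_top ENNReal.one_ne_top <| by
    refine ((one_mul (excess f 1)).symm.trans_le (mul_excess_le f 1)).trans_lt ?_ |>.ne
    exact ENNReal.pow_lt_top (mem_LpSubmodule_iff.1 hf)

/-! ### Almost everywhere convergence -/

theorem end_apply_sub (S : Module.End 𝕜 (L1AddLinf 𝕜 μ)) (f g : L1AddLinf 𝕜 μ) :
    S (f - g) = S f - S g := by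
  have h := S.map_add (f - g) g
  have e : f - g + g = f := Subtype.ext (sub_add_cancel (f : Ω →ₘ[μ] 𝕜) g)
  rw [e] at h
  have h' : (S f : Ω →ₘ[μ] 𝕜) = S (f - g) + S g := congrArg Subtype.val h
  exact Subtype.ext (eq_sub_of_add_eq h'.symm)

/-- The ergodic averages of `f` converge almost everywhere. -/
def AveragesConverge (T : Module.End 𝕜 (L1AddLinf 𝕜 μ)) (f : L1AddLinf 𝕜 μ) : Prop :=
  ∀ᵐ x ∂μ, ∃ l : 𝕜, Tendsto (fun n => (averageOp T n f : Ω →ₘ[μ] 𝕜) x) atTop (𝓝 l)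

/-- The **Banach principle**: functions that are approximated, in the sense of excesses, by
functions whose averages converge have convergent averages. -/
theorem IsDunfordSchwartz.averagesConverge_of_approx {T : Module.End 𝕜 (L1AddLinf 𝕜 μ)}
    (hT : IsDunfordSchwartz T) (f : L1AddLinf 𝕜 μ)
    (hf : ∀ a : ℝ, 0 < a → ∃ c : L1AddLinf 𝕜 μ, AveragesConverge T c ∧
      excess ((f - c : L1AddLinf 𝕜 μ) : Ω →ₘ[μ] 𝕜) (ENNReal.ofReal a) ≤
        ENNReal.ofReal a * ENNReal.ofReal a) :
    AveragesConverge T f := by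
  have hpos : ∀ k : ℕ, (0 : ℝ) < (1 / 2) ^ k := fun k => by positivity
  -- An excess of at most `a * a`, divided by `a` in the maximal inequality, leaves measure at most
  -- `a = 2^(-k)`; this is summable, so Borel–Cantelli applies.
  choose c hc hfc using fun k : ℕ => hf ((1 / 2) ^ k) (hpos k)
  have hsmall : ∀ k : ℕ, μ {x | ∃ n : ℕ, 2 * (1 / 2 : ℝ) ^ k <
      ‖(averageOp T n (f - c k) : Ω →ₘ[μ] 𝕜) x‖} ≤ ENNReal.ofReal ((1 / 2) ^ k) := fun k =>
    (hT.measure_exists_lt_norm_average_le (f - c k) (hpos k)).trans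
      (ENNReal.div_le_of_le_mul (hfc k))
  have hsum : ∑' k : ℕ, μ {x | ∃ n : ℕ, 2 * (1 / 2 : ℝ) ^ k <
      ‖(averageOp T n (f - c k) : Ω →ₘ[μ] 𝕜) x‖} ≠ ∞ :=
    ne_top_of_le_ne_top summable_geometric_two.tsum_ofReal_ne_top (ENNReal.tsum_le_tsum hsmall)
  filter_upwards [ae_eventually_notMem hsum, ae_all_iff.2 hc,
    ae_all_iff.2 fun k => ae_all_iff.2 fun n =>
      AEEqFun.coeFn_sub (averageOp T n f : Ω →ₘ[μ] 𝕜) (averageOp T n (c k) : Ω →ₘ[μ] 𝕜)]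
    with x h1 h2 h3
  refine cauchySeq_tendsto_of_complete (Metric.cauchySeq_iff'.2 fun ε hε => ?_)
  have h4 : Tendsto (fun k : ℕ => 2 * (1 / 2 : ℝ) ^ k) atTop (𝓝 0) := by
    simpa using (tendsto_pow_atTop_nhds_zero_of_lt_one (r := (1 / 2 : ℝ))
      (by norm_num) (by norm_num)).const_mul 2
  obtain ⟨k, hk, hkε⟩ := (h1.and (h4.eventually (gt_mem_nhds (show 0 < ε / 3 by positivity)))).exists
  replace hk : ∀ m : ℕ, ‖(averageOp T m f : Ω →ₘ[μ] 𝕜) x - (averageOp T m (c k) : Ω →ₘ[μ] 𝕜) x‖ ≤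
      2 * (1 / 2 : ℝ) ^ k := fun m => by
    rw [← Pi.sub_apply, ← h3 k m, ← Submodule.coe_sub, ← end_apply_sub]
    exact not_lt.1 fun hlt => hk ⟨m, hlt⟩
  obtain ⟨l, hl⟩ := h2 k
  obtain ⟨N, hN⟩ := Metric.cauchySeq_iff'.1 hl.cauchySeq (ε / 3) (by positivity)
  refine ⟨N, fun n hn => ?_⟩
  have h5 := hN n hn
  rw [dist_eq_norm] at h5 ⊢
  have h6 : ∀ u v w z : 𝕜, u - v = (u - w) + (w - z) - (v - z) := fun u v w z => by ring
  rw [h6 _ _ ((averageOp T n (c k) : Ω →ₘ[μ] 𝕜) x) ((averageOp T N (c k) : Ω →ₘ[μ] 𝕜) x)]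
  refine (norm_sub_le _ _).trans_lt ((add_le_add_left (norm_add_le _ _) _).trans_lt ?_)
  linarith [hk n, hk N]

theorem AveragesConverge.add {T : Module.End 𝕜 (L1AddLinf 𝕜 μ)} {f g : L1AddLinf 𝕜 μ}
    (hf : AveragesConverge T f) (hg : AveragesConverge T g) : AveragesConverge T (f + g) := by
  filter_upwards [hf, hg, ae_all_iff.2 fun n =>
    AEEqFun.coeFn_add (averageOp T n f : Ω →ₘ[μ] 𝕜) (averageOp T n g : Ω →ₘ[μ] 𝕜)]
    with x ⟨l, hl⟩ ⟨m, hm⟩ h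
  refine ⟨l + m, ?_⟩
  simp only [map_add, Submodule.coe_add, h, Pi.add_apply]
  exact hl.add hm

theorem averagesConverge_of_fixed {T : Module.End 𝕜 (L1AddLinf 𝕜 μ)} {f : L1AddLinf 𝕜 μ}
    (hf : T f = f) : AveragesConverge T f := by
  have h : ∀ n : ℕ, n ≠ 0 → averageOp T n f = f := fun n hn => by
    have : ∀ k : ℕ, (T ^ k) f = f := fun k => by
      induction k with
      | zero => simp
      | succ k ih => rw [pow_succ, Module.End.mul_apply, hf, ih]
    rw [averageOp_apply, ergodicAverage]
    simp only [this]
    rw [Finset.sum_const, Finset.card_range, ← Nat.cast_smul_eq_nsmul 𝕜, smul_smul,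
      inv_mul_cancel₀ (by exact_mod_cast hn), one_smul]
  refine Eventually.of_forall fun x => ⟨(f : Ω →ₘ[μ] 𝕜) x, ?_⟩
  refine tendsto_const_nhds.congr' ?_
  filter_upwards [eventually_ne_atTop 0] with n hn
  rw [h n hn]

/-- Since `∑ n⁻²` converges, `∑ |h n / n|²` is integrable, hence finite a.e., and its terms tend to
`0`. -/
theorem tendsto_inv_mul_of_eLpNorm_two_le {h : ℕ → Ω →ₘ[μ] 𝕜} {C : ℝ≥0∞} (hC : C ≠ ∞)
    (hh : ∀ n, eLpNorm (h n) 2 μ ≤ C) :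
    ∀ᵐ x ∂μ, Tendsto (fun n : ℕ => (n : 𝕜)⁻¹ * h n x) atTop (𝓝 0) := by
  have hm : ∀ n : ℕ, AEMeasurable (fun x => ‖(n : 𝕜)⁻¹‖ₑ ^ (2 : ℝ) * ‖h n x‖ₑ ^ (2 : ℝ)) μ :=
    fun n => ((h n).aestronglyMeasurable.enorm.pow_const 2).const_mul _
  have h1 : ∀ n : ℕ, ∫⁻ x, ‖(n : 𝕜)⁻¹‖ₑ ^ (2 : ℝ) * ‖h n x‖ₑ ^ (2 : ℝ) ∂μ ≤
      ENNReal.ofReal (((n : ℝ) ^ 2)⁻¹) * C ^ 2 := fun n => by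
    rw [lintegral_const_mul'' _ ((h n).aestronglyMeasurable.enorm.pow_const 2), ← eLpNorm_two_sq]
    gcongr
    · rw [← ofReal_norm, norm_inv, RCLike.norm_natCast, ENNReal.rpow_two,
        ← ENNReal.ofReal_pow (by positivity), inv_pow]
    · exact hh n
  have h2 : ∫⁻ x, ∑' n : ℕ, ‖(n : 𝕜)⁻¹‖ₑ ^ (2 : ℝ) * ‖h n x‖ₑ ^ (2 : ℝ) ∂μ ≠ ∞ := by
    rw [lintegral_tsum hm]
    refine ne_top_of_le_ne_top ?_ (ENNReal.tsum_le_tsum h1)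
    rw [ENNReal.tsum_mul_right]
    exact ENNReal.mul_ne_top
      (Real.summable_nat_pow_inv.2 one_lt_two).tsum_ofReal_ne_top (ENNReal.pow_ne_top hC)
  filter_upwards [ae_lt_top' (AEMeasurable.tsum hm) h2] with x hx
  have h3 := ENNReal.tendsto_atTop_zero_of_tsum_ne_top hx.ne
  have h4 := h3.ennrpow_const (1 / 2 : ℝ)
  rw [ENNReal.zero_rpow_of_pos (by norm_num)] at h4
  rw [tendsto_zero_iff_enorm_tendsto_zero]
  refine h4.congr fun n => ?_
  rw [← ENNReal.mul_rpow_of_nonneg _ _ (by norm_num), ← ENNReal.rpow_mul, enorm_mul]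
  norm_num

/-- The averages telescope to `(g - T^n g) / n`, which tends to `0` a.e. because the `L²` norms of
`T^n g` are bounded. -/
theorem IsDunfordSchwartz.averagesConverge_sub_apply {T : Module.End 𝕜 (L1AddLinf 𝕜 μ)}
    (hT : IsDunfordSchwartz T) {g : L1AddLinf 𝕜 μ}
    (hg : (g : Ω →ₘ[μ] 𝕜) ∈ Lp.LpSubmodule 𝕜 𝕜 2 μ) : AveragesConverge T (g - T g) := by
  have h1 : ∀ n : ℕ, averageOp T n (g - T g) = (n : 𝕜)⁻¹ • (g - (T ^ n) g) := fun n => by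
    rw [averageOp_apply, ergodicAverage]
    congr 1
    have : ∀ k : ℕ, (T ^ k) (g - T g) = (T ^ k) g - (T ^ (k + 1)) g := fun k => by
      rw [end_apply_sub, pow_succ, Module.End.mul_apply]
    simp only [this]
    rw [Finset.sum_range_sub' fun k => (T ^ k) g]
    simp
  have h2 := tendsto_inv_mul_of_eLpNorm_two_le (mem_LpSubmodule_iff.1 hg).ne fun n =>
    eLpNorm_pow_le (fun f _ => hT.eLpNorm_two_le f) g hg n
  have h3 := tendsto_inv_mul_of_eLpNorm_two_le (mem_LpSubmodule_iff.1 hg).ne fun _ => le_rfl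
  filter_upwards [h2, h3,
    ae_all_iff.2 fun n => AEEqFun.coeFn_sub (g : Ω →ₘ[μ] 𝕜) ((T ^ n) g : Ω →ₘ[μ] 𝕜),
    ae_all_iff.2 fun n : ℕ => AEEqFun.coeFn_smul (n : 𝕜)⁻¹
      ((g - (T ^ n) g : L1AddLinf 𝕜 μ) : Ω →ₘ[μ] 𝕜)] with x h2 h3 h4 h5
  refine ⟨0, ?_⟩
  have h6 := h3.sub h2
  rw [sub_zero] at h6
  refine h6.congr fun n => ?_
  rw [h1, Submodule.coe_smul, h5, Pi.smul_apply, Submodule.coe_sub, h4, Pi.sub_apply, smul_eq_mul,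
    mul_sub]

/-- A contraction `S` of a Hilbert space has the property that the vectors `p + (g - S g)` with
`S p = p` are dense. -/
theorem exists_fixed_add_sub_near {H : Type*} [NormedAddCommGroup H] [InnerProductSpace 𝕜 H]
    [CompleteSpace H] (S : H →L[𝕜] H) (hS : ‖S‖ ≤ 1) (x : H) {ε : ℝ} (hε : 0 < ε) :
    ∃ p g : H, S p = p ∧ ‖x - (p + (g - S g))‖ < ε := by
  have hmean := S.tendsto_birkhoffAverage_orthogonalProjection hS x
  set p : H := ((S.eqLocus (1 : H →L[𝕜] H)).orthogonalProjectionOnto x : H) with hp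
  have hpS : S p = p := ((S.eqLocus (1 : H →L[𝕜] H)).orthogonalProjectionOnto x).2
  obtain ⟨n, hn, hn0⟩ :=
    ((Metric.tendsto_nhds.1 hmean ε hε).and (eventually_ne_atTop 0)).exists
  have hn0' : (n : 𝕜) ≠ 0 := by exact_mod_cast hn0
  -- The difference of `x` and its mean is a coboundary, while the means converge to the fixed
  -- vector `p` by von Neumann's theorem.
  have hrange : ∀ k : ℕ, x - S^[k] x ∈ LinearMap.range (1 - (S : H →ₗ[𝕜] H)) := fun k => by
    induction k with
    | zero => simp
    | succ k ih =>
      have : x - S^[k + 1] x = (x - S^[k] x) + (1 - (S : H →ₗ[𝕜] H)) (S^[k] x) := by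
        rw [Function.iterate_succ_apply']
        simp
      rw [this]
      exact add_mem ih (LinearMap.mem_range_self _ _)
  have hmem : x - birkhoffAverage 𝕜 S _root_.id n x ∈ LinearMap.range (1 - (S : H →ₗ[𝕜] H)) := by
    have : x - birkhoffAverage 𝕜 S _root_.id n x =
        (n : 𝕜)⁻¹ • ∑ k ∈ Finset.range n, (x - S^[k] x) := by
      rw [birkhoffAverage, birkhoffSum, Finset.sum_sub_distrib, smul_sub, Finset.sum_const,
        Finset.card_range, ← Nat.cast_smul_eq_nsmul 𝕜, smul_smul, inv_mul_cancel₀ hn0', one_smul]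
      rfl
    rw [this]
    exact Submodule.smul_mem _ _ (Submodule.sum_mem _ fun k _ => hrange k)
  obtain ⟨g, hg⟩ := hmem
  refine ⟨p, g, hpS, ?_⟩
  have hg' : g - S g = x - birkhoffAverage 𝕜 S _root_.id n x := by simpa using hg
  have h : x - (p + (x - birkhoffAverage 𝕜 S _root_.id n x)) =
      birkhoffAverage 𝕜 S _root_.id n x - p := by abel
  rwa [hg', h, ← dist_eq_norm]

theorem IsDunfordSchwartz.averagesConverge_of_mem_L2 {T : Module.End 𝕜 (L1AddLinf 𝕜 μ)}
    (hT : IsDunfordSchwartz T) {f : L1AddLinf 𝕜 μ}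
    (hf : (f : Ω →ₘ[μ] 𝕜) ∈ Lp.LpSubmodule 𝕜 𝕜 2 μ) : AveragesConverge T f := by
  have hT2 := fun (g : L1AddLinf 𝕜 μ) (_ : (g : Ω →ₘ[μ] 𝕜) ∈ Lp.LpSubmodule 𝕜 𝕜 2 μ) =>
    hT.eLpNorm_two_le g
  let S : Lp 𝕜 2 μ →L[𝕜] Lp 𝕜 2 μ := (restrictLp T L2_le hT2).mkContinuous 1 fun g => by
    rw [one_mul]; exact norm_restrictLp_le L2_le hT2 g
  have hS : ‖S‖ ≤ 1 := LinearMap.mkContinuous_norm_le _ zero_le_one _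
  refine hT.averagesConverge_of_approx f fun a ha => ?_
  let F : Lp 𝕜 2 μ := ⟨f, hf⟩
  -- The tolerance `√(a³)` is dictated by `a * excess ≤ ‖·‖₂²`, which then yields excess at most `a
  -- * a`.
  obtain ⟨p, g, hp, hpg⟩ := exists_fixed_add_sub_near S hS F
    (show 0 < Real.sqrt (a * a * a) by positivity)
  let P : L1AddLinf 𝕜 μ := ⟨p, L2_le p.2⟩
  let G : L1AddLinf 𝕜 μ := ⟨g, L2_le g.2⟩
  have hP : T P = P := Subtype.ext (congrArg (Subtype.val : Lp 𝕜 2 μ → Ω →ₘ[μ] 𝕜) hp)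
  refine ⟨P + (G - T G), (averagesConverge_of_fixed hP).add (hT.averagesConverge_sub_apply g.2), ?_⟩
  have hcoe : ((f - (P + (G - T G)) : L1AddLinf 𝕜 μ) : Ω →ₘ[μ] 𝕜) =
      ((F - (p + (g - S g)) : Lp 𝕜 2 μ) : Ω →ₘ[μ] 𝕜) := rfl
  have ha0 : ENNReal.ofReal a ≠ 0 := by simpa using ha
  rw [hcoe, ← ENNReal.mul_le_mul_iff_right ha0 ENNReal.ofReal_ne_top]
  refine (mul_excess_le _ _).trans ?_
  rw [← Lp.enorm_def, ← ofReal_norm, ← ENNReal.ofReal_mul ha.le, ← ENNReal.ofReal_mul ha.le,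
    ← ENNReal.ofReal_pow (norm_nonneg _)]
  refine ENNReal.ofReal_le_ofReal ?_
  calc ‖F - (p + (g - S g))‖ ^ 2 ≤ Real.sqrt (a * a * a) ^ 2 := by gcongr
    _ = a * (a * a) := by rw [Real.sq_sqrt (by positivity), mul_assoc]

/-! ### Functions with finite excesses -/

theorem exists_excess_natCast_lt {u : Ω →ₘ[μ] 𝕜} (hu : u ∈ Lp.LpSubmodule 𝕜 𝕜 1 μ) {ε : ℝ≥0∞}
    (hε : 0 < ε) : ∃ n : ℕ, excess u (n : ℝ≥0∞) < ε := by
  have hu' : ∫⁻ x, ‖u x‖ₑ ∂μ ≠ ∞ := by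
    rw [← eLpNorm_one_eq_lintegral_enorm]
    exact (mem_LpSubmodule_iff.1 hu).ne
  have h : Tendsto (fun n : ℕ => excess u (n : ℝ≥0∞)) atTop (𝓝 (∫⁻ _, 0 ∂μ)) := by
    refine tendsto_lintegral_of_dominated_convergence' (fun x => ‖u x‖ₑ)
      (fun n => aemeasurable_enorm_sub u n) (fun n => Eventually.of_forall fun x => tsub_le_self)
      hu' (Eventually.of_forall fun x => ?_)
    refine tendsto_const_nhds.congr' ?_
    obtain ⟨N, hN⟩ := ENNReal.exists_nat_gt (enorm_ne_top (x := u x))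
    filter_upwards [eventually_ge_atTop N] with n hn
    exact (tsub_eq_zero_of_le (hN.le.trans (by exact_mod_cast hn))).symm
  rw [lintegral_zero] at h
  exact (h.eventually (gt_mem_nhds hε)).exists

theorem clipAE_mem_L2 {u : Ω →ₘ[μ] 𝕜} (hu : u ∈ Lp.LpSubmodule 𝕜 𝕜 1 μ) {a : ℝ} (ha : 0 ≤ a) :
    clipAE a u ∈ Lp.LpSubmodule 𝕜 𝕜 2 μ := by
  have h : eLpNorm (clipAE a u) 2 μ ^ 2 ≤ ENNReal.ofReal a * eLpNorm u 1 μ := by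
    rw [eLpNorm_two_sq, eLpNorm_one_eq_lintegral_enorm,
      ← lintegral_const_mul'' _ u.aestronglyMeasurable.enorm]
    refine lintegral_mono_ae ?_
    filter_upwards [coeFn_clipAE a u] with x hx
    rw [hx, ENNReal.rpow_two, sq]
    refine mul_le_mul' (enorm_clip_le ha _) ?_
    rw [← ofReal_norm, ← ofReal_norm, norm_clip ha]
    exact ENNReal.ofReal_le_ofReal (min_le_left _ _)
  refine mem_LpSubmodule_iff.2 (lt_top_iff_ne_top.2 fun htop => ?_)
  rw [htop] at h
  exact (ENNReal.mul_lt_top ENNReal.ofReal_lt_top (mem_LpSubmodule_iff.1 hu)).not_ge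
    (by simpa using h)

/-- Approximate only the integrable part `u` above height `a`, by its truncation at a large `n`,
which lies in `L²`. The neglected part below `a` is invisible to the excess over `a`. -/
theorem IsDunfordSchwartz.averagesConverge_of_excess_ne_top {T : Module.End 𝕜 (L1AddLinf 𝕜 μ)}
    (hT : IsDunfordSchwartz T) {f : L1AddLinf 𝕜 μ}
    (hf : ∀ a : ℝ, 0 < a → excess (f : Ω →ₘ[μ] 𝕜) (ENNReal.ofReal a) ≠ ∞) :
    AveragesConverge T f := by
  refine hT.averagesConverge_of_approx f fun a ha => ?_
  obtain ⟨f, hfX⟩ := f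
  have hu : f - clipAE a f ∈ Lp.LpSubmodule 𝕜 𝕜 1 μ := sub_clipAE_mem_L1 ha.le (hf a ha)
  set u := f - clipAE a f with hudef
  have ha' : 0 < ENNReal.ofReal a := ENNReal.ofReal_pos.2 ha
  obtain ⟨n, hn⟩ := exists_excess_natCast_lt hu (ENNReal.mul_pos ha'.ne' ha'.ne')
  have hn0 : (0 : ℝ) ≤ n := n.cast_nonneg
  have hc := clipAE_mem_L2 hu hn0
  refine ⟨⟨clipAE n u, L2_le hc⟩, hT.averagesConverge_of_mem_L2 hc, ?_⟩
  have h1 : ((⟨f, hfX⟩ - ⟨clipAE n u, L2_le hc⟩ : L1AddLinf 𝕜 μ) : Ω →ₘ[μ] 𝕜) =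
      (u - clipAE n u) + clipAE a f := by
    have : f - clipAE n u = (u - clipAE n u) + clipAE a f := by rw [hudef]; abel
    exact this
  rw [h1]
  refine (excess_add_le _ _ (eLpNorm_top_clipAE_le ha.le f)).trans ?_
  rw [eLpNorm_one_sub_clipAE hn0, ENNReal.ofReal_natCast]
  exact hn.le

/-! ### Fully symmetric spaces without the constant functions -/

/-- For `c ≥ a` the left side is zero; for `c < a` the right side is infinite, being at least `(a -
c) * ∞`. -/
theorem excess_const_le {f : Ω →ₘ[μ] 𝕜} {a : ℝ} (ha : 0 < a)
    (h : μ {x | ENNReal.ofReal a < ‖f x‖ₑ} = ∞) (c : ℝ≥0∞) :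
    excess ((a : 𝕜) • (1 : Ω →ₘ[μ] 𝕜)) c ≤ excess f c := by
  rcases le_or_gt (ENNReal.ofReal a) c with hac | hac
  · refine le_trans (le_of_eq ?_) zero_le
    rw [excess, ← lintegral_zero (μ := μ)]
    refine lintegral_congr_ae ?_
    filter_upwards [AEEqFun.coeFn_smul (a : 𝕜) (1 : Ω →ₘ[μ] 𝕜),
      AEEqFun.coeFn_one (β := 𝕜) (μ := μ)] with x h1 h2
    rw [h1, Pi.smul_apply, h2, Pi.one_apply, smul_eq_mul, mul_one, ← ofReal_norm,
      RCLike.norm_ofReal, abs_of_pos ha]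
    exact tsub_eq_zero_of_le hac
  · have h1 := mul_meas_ge_le_lintegral₀ (aemeasurable_enorm_sub f c) (ENNReal.ofReal a - c)
    have h2 : μ {x | ENNReal.ofReal a - c ≤ ‖f x‖ₑ - c} = ∞ := by
      refine top_le_iff.1 (h.symm.le.trans (measure_mono fun x hx => ?_))
      simp only [Set.mem_ofPred_eq] at hx ⊢
      exact tsub_le_tsub_right hx.le c
    rw [h2, ENNReal.mul_top (tsub_pos_of_lt hac).ne'] at h1
    exact le_top.trans h1

theorem FullySymmetricSpace.measure_lt_enorm_ne_top (E : FullySymmetricSpace 𝕜 μ)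
    (hE : (1 : Ω →ₘ[μ] 𝕜) ∉ E.carrier) {f : Ω →ₘ[μ] 𝕜} (hf : f ∈ E.carrier) {a : ℝ}
    (ha : 0 < a) : μ {x | ENNReal.ofReal a < ‖f x‖ₑ} ≠ ∞ := by
  intro h
  have hle := excess_const_le ha h
  obtain ⟨b, hb, hfb⟩ := exists_excess_ne_top (E.carrier_le hf)
  obtain ⟨hmem, -⟩ := E.fully_symmetric ⟨f, hf⟩ ((a : 𝕜) • (1 : Ω →ₘ[μ] 𝕜))
    (mem_L1AddLinf_of_excess_ne_top hb ((hle b).trans_lt hfb.lt_top).ne)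
    (submajorized_of_excess_le fun c _ => hle c)
  refine hE ?_
  have ha' : (a : 𝕜) ≠ 0 := by exact_mod_cast ha.ne'
  have := E.carrier.smul_mem (a : 𝕜)⁻¹ hmem
  rwa [smul_smul, inv_mul_cancel₀ ha', one_smul] at this

/-- Some level `b` has finite excess. Lowering it to `a` costs at most `b` on the set `{|f| > a}`,
which has finite measure. -/
theorem FullySymmetricSpace.excess_ne_top (E : FullySymmetricSpace 𝕜 μ)
    (hE : (1 : Ω →ₘ[μ] 𝕜) ∉ E.carrier) {f : Ω →ₘ[μ] 𝕜} (hf : f ∈ E.carrier) {a : ℝ}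
    (ha : 0 < a) : excess f (ENNReal.ofReal a) ≠ ∞ := by
  obtain ⟨b, hb, hfb⟩ := exists_excess_ne_top (E.carrier_le hf)
  have hms : MeasurableSet {x | ENNReal.ofReal a < ‖f x‖ₑ} :=
    measurableSet_lt measurable_const f.stronglyMeasurable.enorm
  have h1 : excess f (ENNReal.ofReal a) ≤
      excess f b + b * μ {x | ENNReal.ofReal a < ‖f x‖ₑ} := by
    rw [excess, excess, ← lintegral_indicator_const hms,
      ← lintegral_add_left' (aemeasurable_enorm_sub f b)]
    refine lintegral_mono fun x => ?_
    by_cases hx : ENNReal.ofReal a < ‖f x‖ₑ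
    · rw [Set.indicator_of_mem (by exact hx)]
      exact tsub_le_self.trans le_tsub_add
    · rw [tsub_eq_zero_of_le (not_lt.1 hx)]
      exact zero_le
  exact (h1.trans_lt (ENNReal.add_lt_top.2 ⟨hfb.lt_top, ENNReal.mul_lt_top hb.lt_top
    (E.measure_lt_enorm_ne_top hE hf ha).lt_top⟩)).ne

theorem excess_le_of_tendsto {u : ℕ → Ω →ₘ[μ] 𝕜} {f g : Ω →ₘ[μ] 𝕜} {a : ℝ≥0∞} (ha : a ≠ ∞)
    (hu : ∀ n, excess (u n) a ≤ excess f a)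
    (hlim : ∀ᵐ x ∂μ, Tendsto (fun n => u n x) atTop (𝓝 (g x))) : excess g a ≤ excess f a := by
  calc excess g a = ∫⁻ x, liminf (fun n => ‖u n x‖ₑ - a) atTop ∂μ := by
        refine lintegral_congr_ae ?_
        filter_upwards [hlim] with x hx
        exact (ENNReal.Tendsto.sub hx.enorm tendsto_const_nhds (Or.inr ha)).liminf_eq.symm
    _ ≤ liminf (fun n => excess (u n) a) atTop :=
        lintegral_liminf_le' fun n => aemeasurable_enorm_sub (u n) a
    _ ≤ liminf (fun _ : ℕ => excess f a) atTop := liminf_le_liminf (Eventually.of_forall hu)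
    _ = excess f a := liminf_const _

/-- The individual ergodic theorem in fully symmetric spaces without the constant functions, for
Dunford–Schwartz operators, positive or not. -/
theorem IsDunfordSchwartz.averagesConvergeIn {T : Module.End 𝕜 (L1AddLinf 𝕜 μ)}
    (hT : IsDunfordSchwartz T) (E : FullySymmetricSpace 𝕜 μ)
    (hE : (1 : Ω →ₘ[μ] 𝕜) ∉ E.carrier) : AveragesConvergeIn E T := by
  intro f hf
  have hconv : AveragesConverge T ⟨f, E.carrier_le hf⟩ :=
    hT.averagesConverge_of_excess_ne_top fun a ha => E.excess_ne_top hE hf ha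
  obtain ⟨g, hg, hlim⟩ := exists_stronglyMeasurable_limit_of_tendsto_ae
    (fun n => AEEqFun.aestronglyMeasurable (averageOp T n ⟨f, E.carrier_le hf⟩ : Ω →ₘ[μ] 𝕜)) hconv
  obtain ⟨fhat, hlim'⟩ : ∃ fhat : Ω →ₘ[μ] 𝕜, ∀ᵐ x ∂μ, Tendsto
      (fun n => (averageOp T n ⟨f, E.carrier_le hf⟩ : Ω →ₘ[μ] 𝕜) x) atTop (𝓝 (fhat x)) := by
    refine ⟨AEEqFun.mk g hg.aestronglyMeasurable, ?_⟩
    filter_upwards [hlim, AEEqFun.coeFn_mk (μ := μ) g hg.aestronglyMeasurable] with x hx hgx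
    rwa [hgx]
  -- The averages are themselves Dunford–Schwartz operators, so their excess bounds pass to the
  -- limit by Fatou.
  have hle : ∀ a : ℝ≥0∞, a ≠ ∞ → excess fhat a ≤ excess f a := fun a ha =>
    excess_le_of_tendsto ha (fun n => (hT.average n).excess_le ⟨f, E.carrier_le hf⟩ ha) hlim'
  obtain ⟨b, hb, hfb⟩ := exists_excess_ne_top (E.carrier_le hf)
  obtain ⟨hmem, -⟩ := E.fully_symmetric ⟨f, hf⟩ fhat
    (mem_L1AddLinf_of_excess_ne_top hb ((hle b hb).trans_lt hfb.lt_top).ne)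
    (submajorized_of_excess_le hle)
  refine ⟨_, hmem, ?_⟩
  simpa only [averageOp_apply] using hlim'

end ErgodicFS

end

theorem theoremt5 {Ω : Type*} [MeasurableSpace Ω] (μ : Measure Ω) (hμ : μ Set.univ = ∞) :
    (∀ E : ErgodicFS.FullySymmetricSpace ℝ μ, (1 : Ω →ₘ[μ] ℝ) ∉ E.carrier →
      ∀ T : Module.End ℝ (ErgodicFS.L1AddLinf ℝ μ), ErgodicFS.IsDunfordSchwartz T →
        ErgodicFS.AveragesConvergeIn E T) ∧
    (∀ E : ErgodicFS.FullySymmetricSpace ℂ μ, (1 : Ω →ₘ[μ] ℂ) ∉ E.carrier →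
      ∀ T : Module.End ℂ (ErgodicFS.L1AddLinf ℂ μ), ErgodicFS.IsDunfordSchwartz T →
        ErgodicFS.IsPositiveOperator T → ErgodicFS.AveragesConvergeIn E T) :=
  ⟨fun E hE _ hT => hT.averagesConvergeIn E hE, fun E hE _ hT _ => hT.averagesConvergeIn E hE⟩
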